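/- For every \(n\) there is a periodic triangulation \(\mathcal{S}_*\) of \(\mathbb{R}^n\) (a locally finite triangulation into nondegenerate simplices with \(n+1\) vertices, invariant under the translations by the vectors of a basis of \(\mathbb{R}^n\)) with the following property. Let \(p, q \in [1, \infty)\) and let \(u : \mathbb{R}^n \to \mathbb{R}\) be a function, defined at every point, such that \(u \in L^q(\mathbb{R}^n)\), \(u\) is weakly differentiable and \(Du \in L^p(\mathbb{R}^n)\). Then for every \(\varepsilon > 0\) there exist \(r > 0\) and \(h \in \mathbb{R}^n\) such that all vertices of the triangulation \(\mathcal{S} = \{ r\Sigma + h : \Sigma \in \mathcal{S}_* \}\) are Lebesgue points of \(u\), the function \(u - \Pi_{\mathcal{S}} u\) is weakly differentiable, and \[ \int_{\mathbb{R}^n} |D(u - \Pi_{\mathcal{S}} u)|^p + \int_{\mathbb{R}^n} |u - \Pi_{\mathcal{S}} u|^q \le \varepsilon , \] where \(\Pi_{\mathcal{S}} u : \mathbb{R}^n \to \mathbb{R}\) is the Lagrange interpolant of \(u\), that is, the function that is affine on each simplex of \(\mathcal{S}\) and coincides with \(u\) at every vertex of \(\mathcal{S}\). Here \(a\) is a Lebesgue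 point of \(u\) if the mean of \(|u - u(a)|\) over the ball \(B_\rho(a)\) tends to \(0\) as \(\rho \to 0\). -/

import Mathlib

open MeasureTheory Filter Topology
open scoped ENNReal ContDiff

/-- `G` is the weak derivative `Du` of `u : ℝⁿ → ℝ`: both are locally integrable, and
`∫ u ∂ₑφ = - ∫ (Du)[e] φ` for every direction `e` and every smooth compactly supported `φ`. -/
structure HasWeakDeriv {n : ℕ} (u : EuclideanSpace ℝ (Fin n) → ℝ)
    (G : EuclideanSpace ℝ (Fin n) → (EuclideanSpace ℝ (Fin n) →L[ℝ] ℝ)) : Prop where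
  locallyIntegrable : LocallyIntegrable u volume
  locallyIntegrable_deriv : LocallyIntegrable G volume
  integral_mul_fderiv : ∀ φ : EuclideanSpace ℝ (Fin n) → ℝ,
    ContDiff ℝ ∞ φ → HasCompactSupport φ → ∀ e : EuclideanSpace ℝ (Fin n),
      ∫ x, u x * fderiv ℝ φ x e = - ∫ x, G x e * φ x

/-- `a` is a Lebesgue point of `u`: the mean of `|u - u a|` over the ball of radius `ρ`
centred at `a` tends to `0` as `ρ → 0`. -/
def IsLebesguePoint {n : ℕ} (u : EuclideanSpace ℝ (Fin n) → ℝ)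
    (a : EuclideanSpace ℝ (Fin n)) : Prop :=
  Tendsto (fun ρ : ℝ => ⨍⁻ x in Metric.ball a ρ, ‖u x - u a‖ₑ ∂volume) (𝓝[>] 0) (𝓝 0)

/-- A triangulation of `ℝⁿ`: a locally finite simplicial complex that covers `ℝⁿ` and in which
every face is a face of a nondegenerate simplex with `n + 1` vertices. The faces of a
`Geometry.SimplicialComplex` are stored as their finite sets of vertices; these are affinely
independent, and two simplices meet along the convex hull of their common vertices. -/
structure IsTriangulation {n : ℕ}
    (S : Geometry.SimplicialComplex ℝ (EuclideanSpace ℝ (Fin n))) : Prop where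
  space_eq : S.space = Set.univ
  pure : ∀ s ∈ S.faces, ∃ t ∈ S.faces, s ⊆ t ∧ t.card = n + 1
  locallyFinite : LocallyFinite
    (fun s : S.faces => convexHull ℝ ((s : Finset (EuclideanSpace ℝ (Fin n))) :
      Set (EuclideanSpace ℝ (Fin n))))

/-- `S = r T + h`: the simplices of `S` are exactly the images of the simplices of `T` under
the map `x ↦ r x + h`. -/
def IsDilatedTranslate {n : ℕ} (T S : Geometry.SimplicialComplex ℝ (EuclideanSpace ℝ (Fin n)))
    (r : ℝ) (h : EuclideanSpace ℝ (Fin n)) : Prop :=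
  ∀ s : Finset (EuclideanSpace ℝ (Fin n)), s ∈ S.faces ↔
    ∃ t ∈ T.faces, (s : Set (EuclideanSpace ℝ (Fin n))) =
      (fun x => r • x + h) '' (t : Set (EuclideanSpace ℝ (Fin n)))

/-- `T` is periodic: it is invariant under the translations by the vectors of a basis of `ℝⁿ`. -/
def IsPeriodicComplex {n : ℕ}
    (T : Geometry.SimplicialComplex ℝ (EuclideanSpace ℝ (Fin n))) : Prop :=
  ∃ b : Module.Basis (Fin n) ℝ (EuclideanSpace ℝ (Fin n)), ∀ i, IsDilatedTranslate T T 1 (b i)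

/-- `v` is the Lagrange (affine) interpolant `Π_S u` of `u`: it is affine on every simplex of `S`
and takes the same values as `u` at the vertices of `S`. -/
structure IsLagrangeInterpolant {n : ℕ}
    (S : Geometry.SimplicialComplex ℝ (EuclideanSpace ℝ (Fin n)))
    (u v : EuclideanSpace ℝ (Fin n) → ℝ) : Prop where
  affine_on : ∀ s ∈ S.faces, ∃ A : EuclideanSpace ℝ (Fin n) →ᵃ[ℝ] ℝ,
    ∀ x ∈ convexHull ℝ (s : Set (EuclideanSpace ℝ (Fin n))), v x = A x
  eq_on_vertices : ∀ a ∈ S.vertices, v a = u a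

/-- On a triangulation of `ℝⁿ` the Lagrange interpolant is unique. -/
theorem IsLagrangeInterpolant.unique {n : ℕ}
    {S : Geometry.SimplicialComplex ℝ (EuclideanSpace ℝ (Fin n))} (hS : IsTriangulation S)
    {u v w : EuclideanSpace ℝ (Fin n) → ℝ}
    (hv : IsLagrangeInterpolant S u v) (hw : IsLagrangeInterpolant S u w) : v = w := by
  funext x
  have hx : x ∈ S.space := by rw [hS.space_eq]; trivial
  obtain ⟨s, hs, hxs⟩ := Geometry.SimplicialComplex.mem_space_iff.1 hx
  obtain ⟨A, hA⟩ := hv.affine_on s hs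
  obtain ⟨B, hB⟩ := hw.affine_on s hs
  rw [hA x hxs, hB x hxs]
  have key : Set.EqOn A B (s : Set (EuclideanSpace ℝ (Fin n))) := by
    intro a ha
    have hmem := subset_convexHull ℝ _ ha
    have hvert : a ∈ S.vertices :=
      S.down_closed hs (Finset.singleton_subset_iff.2 ha) (Finset.singleton_nonempty a)
    rw [← hA a hmem, ← hB a hmem, hv.eq_on_vertices a hvert, hw.eq_on_vertices a hvert]
  exact AffineMap.eqOn_affineSpan key (convexHull_subset_affineSpan _ hxs)

/-! The triangulation is Kuhn's, with vertex set `ℤⁿ`. Its interpolant has a closed form: with `y =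
(x - h) / r`, the value at `x` is the mean over `θ ∈ [0, 1)` of the data at `⌊y + θ⌋`. As `θ` grows,
these points run through a chain of vertices, and the time spent at a vertex is the barycentric
coordinate of `y` there (`shiftFloor_eq_of_convexCombination`). Uniqueness of barycentric
coordinates, and with it the axioms of a simplicial complex, follows from this formula.

The edges of Kuhn simplices include the coordinate directions, so almost everywhere the `i`-th
partial derivative of the interpolant is a single difference quotient of `u`, of step `r` in
direction `i`, between two vertices near `x` (`ae_lineDeriv_kuhnInterp`). Hence both errors at `x`
are controlled by quantities `f x P`, with `P` a grid point at distance at most `r n` from `x`: `|u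
x - u P|^q` for the function, and for the gradient the `p`-th powers of the differences between the
partial derivatives at `x` and the quotients ending at `P`.

For a fixed grid the values of `u` at the vertices are not controlled by integrals, since the grid
is a null set. Averaging over the translations of the grid removes this obstacle: the sum over grid
points becomes an integral of `∫ f x (x + r ζ) dx` over `‖ζ‖ ≤ n` (`lintegral_gridSum`). Each of
these inner integrals is small for small `r`, because translations are continuous in `L^q` and `L^p`
and because a difference quotient is an average of translates of the weak derivative
(`lintegral_diffQuotient_sub_le`). Some translation is then at least as good as the average, and it
can be chosen outside any null set, in particular so that all vertices are Lebesgue points. -/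

/-! ### The averaging formula and the Kuhn complex -/

/-- The integer point obtained by rounding down the coordinates of `y + θ (1, …, 1)`. -/
noncomputable def shiftFloor {n : ℕ} (y : EuclideanSpace ℝ (Fin n)) (θ : ℝ) : Fin n → ℤ :=
  fun i => ⌊y i + θ⌋

/-- The point `r z + h` of the scaled and translated integer grid. -/
noncomputable def gridPoint {n : ℕ} (r : ℝ) (h : EuclideanSpace ℝ (Fin n)) (z : Fin n → ℤ) :
    EuclideanSpace ℝ (Fin n) :=
  r • WithLp.toLp 2 (fun i => (z i : ℝ)) + h

/-- The interpolant of the values `c` on the grid `r ℤⁿ + h`, affine on the simplices of the Kuhn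
triangulation: the average of `c` over the integer points `⌊y + θ⌋`, `0 ≤ θ < 1`, where
`y = (x - h) / r`. -/
noncomputable def kuhnInterp {n : ℕ} (r : ℝ) (h : EuclideanSpace ℝ (Fin n))
    (c : (Fin n → ℤ) → ℝ) (x : EuclideanSpace ℝ (Fin n)) : ℝ :=
  ∫ θ in Set.Ico (0 : ℝ) 1, c (shiftFloor (r⁻¹ • (x - h)) θ)

/-- The vertex sets of the Kuhn simplices: chains in `ℤⁿ` of which any two elements differ by a
vector with entries in `{0, 1}`, up to sign. -/
def IsKuhnChain {n : ℕ} (t : Finset (Fin n → ℤ)) : Prop :=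
  ∀ a ∈ t, ∀ b ∈ t, (a ≤ b ∧ b ≤ a + 1) ∨ (b ≤ a ∧ a ≤ b + 1)

section Kuhn

variable {n : ℕ}

@[simp] lemma gridPoint_apply (r : ℝ) (h : EuclideanSpace ℝ (Fin n)) (z : Fin n → ℤ) (i : Fin n) :
    gridPoint r h z i = r * z i + h i := by
  simp [gridPoint]

lemma gridPoint_injective {r : ℝ} (hr : 0 < r) (h : EuclideanSpace ℝ (Fin n)) :
    Function.Injective (gridPoint r h) := by
  intro a b hab
  funext i
  have := congrArg (fun p : EuclideanSpace ℝ (Fin n) => p i) hab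
  simp only [gridPoint_apply, add_left_inj] at this
  exact_mod_cast mul_left_cancel₀ hr.ne' this

lemma measurable_shiftFloor (y : EuclideanSpace ℝ (Fin n)) : Measurable (shiftFloor y) := by
  refine measurable_pi_lambda _ fun i => ?_
  exact Int.measurable_floor.comp (measurable_const.add measurable_id)

lemma shiftFloor_mono (y : EuclideanSpace ℝ (Fin n)) : Monotone (shiftFloor y) := by
  intro s t hst i
  exact Int.floor_le_floor (by linarith)

lemma shiftFloor_le_add_one (y : EuclideanSpace ℝ (Fin n)) {s t : ℝ} (hst : t ≤ s + 1) :
    shiftFloor y t ≤ shiftFloor y s + 1 := by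
  intro i
  have : ⌊y i + t⌋ ≤ ⌊y i + s + 1⌋ := Int.floor_le_floor (by linarith)
  rw [Int.floor_add_one] at this
  exact this

lemma shiftFloor_mem_Icc (y : EuclideanSpace ℝ (Fin n)) {θ : ℝ} (hθ : θ ∈ Set.Ico (0 : ℝ) 1) :
    shiftFloor y θ ∈ Set.Icc (shiftFloor y 0) (shiftFloor y 0 + 1) :=
  ⟨shiftFloor_mono y hθ.1, shiftFloor_le_add_one y (by linarith [hθ.2])⟩

/-- A function of `⌊y + θ⌋` is integrable in `θ ∈ [0, 1)`, as it takes finitely many values. -/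
lemma integrableOn_comp_shiftFloor {F : Type*} [NormedAddCommGroup F]
    (c : (Fin n → ℤ) → F) (y : EuclideanSpace ℝ (Fin n)) :
    IntegrableOn (fun θ => c (shiftFloor y θ)) (Set.Ico (0 : ℝ) 1) := by
  have hm : StronglyMeasurable (fun θ => c (shiftFloor y θ)) :=
    (StronglyMeasurable.of_discrete (f := c)).comp_measurable (measurable_shiftFloor y)
  obtain ⟨M, hM⟩ := ((Set.finite_Icc (shiftFloor y 0) (shiftFloor y 0 + 1)).image
    (fun z => ‖c z‖)).bddAbove
  refine IntegrableOn.of_bound (by simp) hm.aestronglyMeasurable M ?_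
  refine (ae_restrict_iff' measurableSet_Ico).2 (Eventually.of_forall fun θ hθ => ?_)
  exact hM ⟨_, shiftFloor_mem_Icc y hθ, rfl⟩

/-- Since `⌊s⌋ = s - fract s` and `fract` has period 1, the mean of `fract (t + θ)` does not depend
on `t` and cancels the mean of `θ`. This makes the averaging formula reproduce the coordinates. -/
lemma integral_floor_add (t : ℝ) : ∫ θ in Set.Ico (0 : ℝ) 1, (⌊t + θ⌋ : ℝ) = t := by
  rw [integral_Ico_eq_integral_Ioc, ← intervalIntegral.integral_of_le zero_le_one]
  have hfr : ∀ a : ℝ, IntervalIntegrable (fun θ : ℝ => Int.fract (a + θ)) volume 0 1 := by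
    intro a
    rw [intervalIntegrable_iff]
    refine IntegrableOn.of_bound (by simp) ?_ 1 (Eventually.of_forall fun θ => ?_)
    · exact (measurable_fract.comp (measurable_const.add measurable_id)).aestronglyMeasurable
    · rw [Real.norm_eq_abs, abs_of_nonneg (Int.fract_nonneg _)]
      exact (Int.fract_lt_one _).le
  have h1 : ∀ θ : ℝ, (⌊t + θ⌋ : ℝ) = (t + θ) - Int.fract (t + θ) := fun θ => by
    rw [Int.fract]; ring
  have h2 : ∫ θ in (0 : ℝ)..1, Int.fract (t + θ) = ∫ θ in (0 : ℝ)..1, Int.fract θ := by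
    have hp : Function.Periodic (Int.fract : ℝ → ℝ) 1 := fun x => Int.fract_add_one x
    have := hp.intervalIntegral_add_eq t 0
    rw [zero_add] at this
    rw [intervalIntegral.integral_comp_add_left (fun θ => Int.fract θ) t, add_zero, this]
  have h3 : ∫ θ in (0 : ℝ)..1, Int.fract θ = ∫ θ in (0 : ℝ)..1, θ := by
    refine intervalIntegral.integral_congr_ae ?_
    have : ∀ᵐ θ : ℝ, θ ≠ 1 := by simp [ae_iff]
    filter_upwards [this] with θ hθ hmem
    rw [Set.uIoc_of_le zero_le_one] at hmem
    exact Int.fract_eq_self.2 ⟨hmem.1.le, lt_of_le_of_ne hmem.2 hθ⟩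
  simp_rw [h1]
  rw [intervalIntegral.integral_sub (Continuous.intervalIntegrable (by fun_prop) _ _) (hfr t), h2,
    h3, intervalIntegral.integral_add (Continuous.intervalIntegrable (by fun_prop) _ _)
    (Continuous.intervalIntegrable (by fun_prop) _ _)]
  simp

open Classical in
/-- The barycentric coordinate of `y` with respect to `a` is the length of an interval of `θ` on
which `⌊y + θ⌋ = a`. -/
lemma shiftFloor_eq_of_convexCombination {t : Finset (Fin n → ℤ)} (ht : IsKuhnChain t)
    {w : (Fin n → ℤ) → ℝ} (hw : ∀ a ∈ t, 0 ≤ w a) (hw1 : ∑ a ∈ t, w a = 1)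
    {y : EuclideanSpace ℝ (Fin n)} (hy : ∀ i, y i = ∑ a ∈ t, w a * a i)
    {a : Fin n → ℤ} (ha : a ∈ t) {θ : ℝ}
    (hθ : θ ∈ Set.Ico (∑ b ∈ t with b < a, w b) ((∑ b ∈ t with b < a, w b) + w a)) :
    shiftFloor y θ = a := by
  funext i
  -- A chain element below `a` contributes between `-w b` and `0`, one above `a` between `0` and `w
  -- b`, and `a` itself nothing. Summed up, this confines `y i - a i` to exactly the range in which
  -- every `θ` of the interval gives floor `a i`.
  have hsplit : ∀ b ∈ t, (if b < a then -w b else 0) ≤ w b * ((b i : ℝ) - a i) ∧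
      w b * ((b i : ℝ) - a i) ≤ w b - (if b < a then w b else 0) - (if b = a then w b else 0) := by
    intro b hb
    have h0 := hw b hb
    rcases eq_or_ne b a with rfl | hne
    · simp
    rcases ht a ha b hb with ⟨h1, h2⟩ | ⟨h1, h2⟩
    · have hnl : ¬ b < a := fun h => absurd (h1.trans_lt h) (lt_irrefl _)
      have e1 : (a i : ℝ) ≤ b i := by exact_mod_cast h1 i
      have e2 : (b i : ℝ) ≤ a i + 1 := by exact_mod_cast h2 i
      simp only [hnl, hne, if_false]
      constructor <;> nlinarith
    · have hl : b < a := lt_of_le_of_ne h1 hne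
      have e1 : (b i : ℝ) ≤ a i := by exact_mod_cast h1 i
      have e2 : (a i : ℝ) ≤ b i + 1 := by exact_mod_cast h2 i
      simp only [hl, hne, if_true, if_false]
      constructor <;> nlinarith
  have hya : y i - a i = ∑ b ∈ t, w b * ((b i : ℝ) - a i) := by
    simp_rw [mul_sub, Finset.sum_sub_distrib, ← Finset.sum_mul, hw1, hy i, one_mul]
  have hlow := Finset.sum_le_sum fun b hb => (hsplit b hb).1
  have hup := Finset.sum_le_sum fun b hb => (hsplit b hb).2
  rw [← hya] at hlow hup
  rw [Finset.sum_sub_distrib, Finset.sum_sub_distrib, hw1, Finset.sum_ite_eq' t a w, if_pos ha,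
    ← Finset.sum_filter] at hup
  have : ∑ b ∈ t, (if b < a then -w b else 0) = -∑ b ∈ t with b < a, w b := by
    rw [Finset.sum_filter, ← Finset.sum_neg_distrib]
    exact Finset.sum_congr rfl fun b _ => by split_ifs <;> simp
  rw [this] at hlow
  obtain ⟨h1, h2⟩ := hθ
  exact Int.floor_eq_iff.2 ⟨by linarith, by linarith⟩

/-- The intervals attached to the elements of `t` are disjoint, because the floor takes different
values on them. They lie in `[0, 1)` and their lengths `w a` add up to 1, so they fill it up to a
null set. -/
lemma integral_comp_shiftFloor_of_convexCombination {t : Finset (Fin n → ℤ)} (ht : IsKuhnChain t)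
    {w : (Fin n → ℤ) → ℝ} (hw : ∀ a ∈ t, 0 ≤ w a) (hw1 : ∑ a ∈ t, w a = 1)
    {y : EuclideanSpace ℝ (Fin n)} (hy : ∀ i, y i = ∑ a ∈ t, w a * a i) (c : (Fin n → ℤ) → ℝ) :
    ∫ θ in Set.Ico (0 : ℝ) 1, c (shiftFloor y θ) = ∑ a ∈ t, w a * c a := by
  classical
  set I : (Fin n → ℤ) → Set ℝ := fun a =>
    Set.Ico (∑ b ∈ t with b < a, w b) ((∑ b ∈ t with b < a, w b) + w a) with hI
  have hfloor : ∀ a ∈ t, ∀ θ ∈ I a, shiftFloor y θ = a := fun a ha θ hθ =>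
    shiftFloor_eq_of_convexCombination ht hw hw1 hy ha hθ
  have hdisj : (t : Set (Fin n → ℤ)).PairwiseDisjoint I := by
    intro a ha b hb hab
    refine Set.disjoint_left.2 fun θ h1 h2 => hab ?_
    rw [← hfloor a ha θ h1, ← hfloor b hb θ h2]
  have hsub : (⋃ a ∈ t, I a) ⊆ Set.Ico (0 : ℝ) 1 := by
    refine Set.iUnion₂_subset fun a ha => Set.Ico_subset_Ico ?_ ?_
    · exact Finset.sum_nonneg fun b hb => hw b (Finset.mem_filter.1 hb).1
    · have : a ∉ t.filter (· < a) := by simp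
      rw [add_comm, ← Finset.sum_insert this, ← hw1]
      refine Finset.sum_le_sum_of_subset_of_nonneg ?_ fun b hb _ => hw b hb
      exact Finset.insert_subset ha (Finset.filter_subset _ _)
  have hmeas : ∀ a ∈ t, MeasurableSet (I a) := fun a _ => measurableSet_Ico
  have hvol : volume (⋃ a ∈ t, I a) = 1 := by
    rw [measure_biUnion_finset hdisj hmeas]
    simp only [hI, Real.volume_Ico, add_sub_cancel_left]
    rw [← ENNReal.ofReal_sum_of_nonneg hw, hw1, ENNReal.ofReal_one]
  have hae : (⋃ a ∈ t, I a) =ᵐ[volume] Set.Ico (0 : ℝ) 1 :=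
    ae_eq_of_subset_of_measure_ge hsub (by rw [hvol]; simp)
      (Finset.measurableSet_biUnion _ hmeas).nullMeasurableSet (by simp)
  rw [← setIntegral_congr_set hae, integral_biUnion_finset t hmeas hdisj]
  · refine Finset.sum_congr rfl fun a ha => ?_
    rw [setIntegral_congr_fun (hmeas a ha) (g := fun _ => c a)
      fun θ hθ => by rw [hfloor a ha θ hθ]]
    simp only [setIntegral_const, hI, smul_eq_mul, Real.volume_real_Ico, add_sub_cancel_left]
    rw [max_eq_left (hw a ha)]
  · intro a ha
    exact (integrableOn_comp_shiftFloor c y).mono_set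
      ((Set.subset_biUnion_of_mem (u := I) ha).trans hsub)

/-- `kuhnInterp` is affine on the simplices spanned by Kuhn chains. -/
lemma kuhnInterp_convexCombination {r : ℝ} (hr : 0 < r) (h : EuclideanSpace ℝ (Fin n))
    {t : Finset (Fin n → ℤ)} (ht : IsKuhnChain t)
    {w : (Fin n → ℤ) → ℝ} (hw : ∀ a ∈ t, 0 ≤ w a) (hw1 : ∑ a ∈ t, w a = 1)
    (c : (Fin n → ℤ) → ℝ) :
    kuhnInterp r h c (∑ a ∈ t, w a • gridPoint r h a) = ∑ a ∈ t, w a * c a := by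
  refine integral_comp_shiftFloor_of_convexCombination ht hw hw1 (fun i => ?_) c
  have : (∑ a ∈ t, w a • gridPoint r h a) i = ∑ a ∈ t, w a * (r * a i + h i) := by
    simp
  rw [PiLp.smul_apply, PiLp.sub_apply, this]
  simp_rw [mul_add, Finset.sum_add_distrib, ← Finset.sum_mul, hw1, one_mul, add_sub_cancel_right,
    smul_eq_mul, Finset.mul_sum]
  refine Finset.sum_congr rfl fun a _ => ?_
  field_simp

/-- Interpolating the indicator of `{a}` returns the weight at `a`, which therefore depends on the
point only and not on its representation. -/
lemma convexCombination_weights_unique {r : ℝ} (hr : 0 < r) (h : EuclideanSpace ℝ (Fin n))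
    {t t' : Finset (Fin n → ℤ)} (ht : IsKuhnChain t) (ht' : IsKuhnChain t')
    {w w' : (Fin n → ℤ) → ℝ} (hw : ∀ a ∈ t, 0 ≤ w a) (hw1 : ∑ a ∈ t, w a = 1)
    (hw' : ∀ a ∈ t', 0 ≤ w' a) (hw1' : ∑ a ∈ t', w' a = 1)
    (heq : ∑ a ∈ t, w a • gridPoint r h a = ∑ a ∈ t', w' a • gridPoint r h a)
    {a : Fin n → ℤ} (ha : a ∈ t) : w a = if a ∈ t' then w' a else 0 := by
  classical
  have h1 := kuhnInterp_convexCombination hr h ht hw hw1 (fun b => if b = a then 1 else 0)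
  have h2 := kuhnInterp_convexCombination hr h ht' hw' hw1' (fun b => if b = a then 1 else 0)
  rw [heq, h2] at h1
  simpa [ha] using h1.symm

/-- An affine relation, scaled down, perturbs the uniform weights into another convex combination of
the same point. Uniqueness of weights forces the relation to vanish. -/
lemma affineIndependent_gridPoint {r : ℝ} (hr : 0 < r) (h : EuclideanSpace ℝ (Fin n))
    {t : Finset (Fin n → ℤ)} (ht : IsKuhnChain t) :
    AffineIndependent ℝ (fun a : t => gridPoint r h a) := by
  classical
  rw [affineIndependent_iff]
  intro s w hw0 hw e he
  have hpos : 0 < t.card := Finset.card_pos.2 ⟨e, e.2⟩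
  have hposR : (0 : ℝ) < t.card := by exact_mod_cast hpos
  set W : (Fin n → ℤ) → ℝ := fun a => if ha : a ∈ t then (if ⟨a, ha⟩ ∈ s then w ⟨a, ha⟩ else 0)
    else 0 with hW
  have hWs : ∀ a : t, W a = if a ∈ s then w a else 0 := fun a => by simp [hW]
  have hWsum : ∑ a ∈ t, W a = 0 := by
    rw [← Finset.sum_coe_sort]
    simp_rw [hWs]
    rw [Finset.sum_ite_mem, Finset.univ_inter, hw0]
  have hWvec : ∑ a ∈ t, W a • gridPoint r h a = 0 := by
    rw [← Finset.sum_coe_sort t (fun a => W a • gridPoint r h a)]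
    simp_rw [hWs, ite_smul, zero_smul]
    rw [Finset.sum_ite_mem, Finset.univ_inter, hw]
  set M : ℝ := 1 + ∑ a ∈ t, |W a| with hM
  have hM0 : 0 < M := by positivity
  -- With `M` bounding every `|W a|`, this choice makes the uniform weight equal to `δ * M`, so the
  -- perturbed weights stay nonnegative.
  set δ : ℝ := (t.card * M)⁻¹ with hδ
  have hδ0 : 0 < δ := by positivity
  have hbound : ∀ a ∈ t, 0 ≤ (t.card : ℝ)⁻¹ + δ * W a := by
    intro a ha
    have h1 : |W a| ≤ M := by
      have := Finset.single_le_sum (f := fun a => |W a|) (fun b _ => abs_nonneg _) ha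
      linarith
    have h2 : -M ≤ W a := (abs_le.1 h1).1
    have h3 : (t.card : ℝ)⁻¹ = δ * M := by rw [hδ]; field_simp
    rw [h3, ← mul_add]
    exact mul_nonneg hδ0.le (by linarith)
  have huniq := convexCombination_weights_unique hr h ht ht (w := fun a => (t.card : ℝ)⁻¹ + δ * W a)
    (w' := fun _ => (t.card : ℝ)⁻¹) hbound
    (by rw [Finset.sum_add_distrib, ← Finset.mul_sum, hWsum]; simp [hposR.ne'])
    (fun _ _ => by positivity) (by simp [hposR.ne'])
    (by simp_rw [add_smul, mul_smul, Finset.sum_add_distrib, ← Finset.smul_sum, hWvec]; simp) e.2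
  rw [if_pos e.2, add_eq_left, mul_eq_zero, or_iff_right hδ0.ne', hWs, if_pos he] at huniq
  exact huniq

/-- Points of a simplex spanned by grid points, as convex combinations. -/
lemma mem_convexHull_map_gridPoint {r : ℝ} (hr : 0 < r) (h : EuclideanSpace ℝ (Fin n))
    {t : Finset (Fin n → ℤ)} {x : EuclideanSpace ℝ (Fin n)} :
    x ∈ convexHull ℝ ((t.map ⟨gridPoint r h, gridPoint_injective hr h⟩ :
      Finset (EuclideanSpace ℝ (Fin n))) : Set (EuclideanSpace ℝ (Fin n))) ↔
    ∃ w : (Fin n → ℤ) → ℝ, (∀ a ∈ t, 0 ≤ w a) ∧ ∑ a ∈ t, w a = 1 ∧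
      ∑ a ∈ t, w a • gridPoint r h a = x := by
  rw [Finset.mem_convexHull']
  constructor
  · rintro ⟨w, h0, h1, h2⟩
    refine ⟨fun a => w (gridPoint r h a), fun a ha => h0 _ (Finset.mem_map_of_mem _ ha), ?_, ?_⟩
    · simpa using h1
    · simpa using h2
  · rintro ⟨w, h0, h1, h2⟩
    have hinv : ∀ a, Function.invFun (gridPoint r h) (gridPoint r h a) = a :=
      Function.leftInverse_invFun (gridPoint_injective hr h)
    refine ⟨fun p => w (Function.invFun (gridPoint r h) p), ?_, ?_, ?_⟩
    · intro p hp
      obtain ⟨a, ha, rfl⟩ := Finset.mem_map.1 hp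
      simpa [hinv] using h0 a ha
    · simpa [hinv] using h1
    · simpa [hinv] using h2

lemma IsKuhnChain.subset {t t' : Finset (Fin n → ℤ)} (ht : IsKuhnChain t) (h : t' ⊆ t) :
    IsKuhnChain t' := fun a ha b hb => ht a (h ha) b (h hb)

/-- The Kuhn triangulation with vertices `r ℤⁿ + h`. -/
noncomputable def kuhnComplex {n : ℕ} (r : ℝ) (hr : 0 < r) (h : EuclideanSpace ℝ (Fin n)) :
    Geometry.SimplicialComplex ℝ (EuclideanSpace ℝ (Fin n)) where
  faces := {s | ∃ t : Finset (Fin n → ℤ), t.Nonempty ∧ IsKuhnChain t ∧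
    s = t.map ⟨gridPoint r h, gridPoint_injective hr h⟩}
  isRelLowerSet_faces := by
    classical
    rintro s ⟨t, ht0, ht, rfl⟩
    refine ⟨ht0.map, fun s' hs' hne => ?_⟩
    obtain ⟨t', ht', rfl⟩ := Finset.subset_map_iff.1 hs'
    exact ⟨t', by simpa using hne, ht.subset ht', rfl⟩
  indep := by
    rintro s ⟨t, ht0, ht, rfl⟩
    have := (affineIndependent_gridPoint hr h ht).range
    refine this.mono ?_
    intro p hp
    obtain ⟨a, ha, rfl⟩ := Finset.mem_map.1 (Finset.mem_coe.1 hp)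
    exact ⟨⟨a, ha⟩, rfl⟩
  inter_subset_convexHull := by
    classical
    rintro s s' ⟨t, ht0, ht, rfl⟩ ⟨t', ht0', ht', rfl⟩ x ⟨hx, hx'⟩
    obtain ⟨w, h0, h1, h2⟩ := (mem_convexHull_map_gridPoint hr h).1 hx
    obtain ⟨w', h0', h1', h2'⟩ := (mem_convexHull_map_gridPoint hr h).1 hx'
    have huniq := fun a (ha : a ∈ t) => convexCombination_weights_unique hr h ht ht' h0 h1 h0' h1'
      (h2.trans h2'.symm) ha
    -- By uniqueness the weights of a common point are supported on the common vertices.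
    have hzero : ∀ a ∈ t, a ∉ t ∩ t' → w a = 0 := by
      intro a ha hna
      rw [huniq a ha, if_neg fun h => hna (Finset.mem_inter.2 ⟨ha, h⟩)]
    rw [← Finset.coe_inter, ← Finset.map_inter]
    refine (mem_convexHull_map_gridPoint hr h).2
      ⟨w, fun a ha => h0 a (Finset.mem_inter.1 ha).1, ?_, ?_⟩
    · rw [← h1]
      exact Finset.sum_subset Finset.inter_subset_left hzero
    · rw [← h2]
      exact Finset.sum_subset Finset.inter_subset_left fun a ha hna => by
        rw [hzero a ha hna, zero_smul]

end Kuhn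

/-! ### Kuhn's complex is a periodic triangulation, and the average is its Lagrange interpolant -/

section KuhnTriangulation

variable {n : ℕ}

/-- The coordinate sum is a rank on a chain: if `b ≤ a` and the sum of `b` is not smaller, the two
coincide. -/
lemma IsKuhnChain.le_of_sum_le {t : Finset (Fin n → ℤ)} (ht : IsKuhnChain t) {a b : Fin n → ℤ}
    (ha : a ∈ t) (hb : b ∈ t) (hab : ∑ i, a i ≤ ∑ i, b i) : a ≤ b ∧ b ≤ a + 1 := by
  rcases ht a ha b hb with h | ⟨h1, h2⟩
  · exact h
  · have : ∀ i ∈ Finset.univ, b i = a i := by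
      refine (Finset.sum_eq_sum_iff_of_le fun i _ => h1 i).1 (le_antisymm ?_ hab)
      exact Finset.sum_le_sum fun i _ => h1 i
    have hba : b = a := funext fun i => this i (Finset.mem_univ i)
    subst hba
    exact ⟨le_refl _, fun i => by simp⟩

lemma IsKuhnChain.exists_min {t : Finset (Fin n → ℤ)} (ht : IsKuhnChain t) (hne : t.Nonempty) :
    ∃ m ∈ t, ∀ a ∈ t, m ≤ a ∧ a ≤ m + 1 := by
  obtain ⟨m, hm, hmin⟩ := Finset.exists_min_image t (fun a => ∑ i, a i) hne
  exact ⟨m, hm, fun a ha => ht.le_of_sum_le hm ha (hmin a ha)⟩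

lemma IsKuhnChain.injOn_sum {t : Finset (Fin n → ℤ)} (ht : IsKuhnChain t) :
    Set.InjOn (fun a : Fin n → ℤ => ∑ i, a i) t := fun _ ha _ hb hab =>
  le_antisymm (ht.le_of_sum_le ha hb (le_of_eq hab)).1 (ht.le_of_sum_le hb ha (ge_of_eq hab)).1

/-- The ranks of the elements are distinct and lie among the `n + 1` consecutive integers that start
at the rank of the minimum. -/
lemma IsKuhnChain.card_le {t : Finset (Fin n → ℤ)} (ht : IsKuhnChain t) : t.card ≤ n + 1 := by
  classical
  rcases t.eq_empty_or_nonempty with rfl | hne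
  · simp
  obtain ⟨m, hm, hmin⟩ := ht.exists_min hne
  have hmaps : ∀ a ∈ t, ∑ i, a i ∈ Finset.Icc (∑ i, m i) (∑ i, m i + n) := by
    intro a ha
    refine Finset.mem_Icc.2 ⟨Finset.sum_le_sum fun i _ => (hmin a ha).1 i, ?_⟩
    refine (Finset.sum_le_sum fun i _ => (hmin a ha).2 i).trans ?_
    simp [Finset.sum_add_distrib]
  refine (Finset.card_le_card_of_injOn _ hmaps ht.injOn_sum).trans ?_
  rw [Int.card_Icc]
  omega

/-- A chain with at most `n` elements can be refined. -/
lemma IsKuhnChain.exists_insert {t : Finset (Fin n → ℤ)} (ht : IsKuhnChain t) (hne : t.Nonempty)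
    (hcard : t.card ≤ n) : ∃ c ∉ t, IsKuhnChain (insert c t) := by
  classical
  obtain ⟨m, hm, hmin⟩ := ht.exists_min hne
  -- With at most `n` elements, some rank `j` among the `n + 1` possible ones is missing. The new
  -- point goes into the gap around it.
  obtain ⟨j, hj, hjt⟩ : ∃ j ∈ Finset.Icc (∑ i, m i) (∑ i, m i + n), ∀ a ∈ t, ∑ i, a i ≠ j := by
    by_contra! hcon
    have hsub : Finset.Icc (∑ i, m i) (∑ i, m i + n) ⊆ t.image fun a => ∑ i, a i := by
      intro j hj
      obtain ⟨a, ha, hav⟩ := hcon j hj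
      exact Finset.mem_image.2 ⟨a, ha, hav⟩
    have := (Finset.card_le_card hsub).trans Finset.card_image_le
    simp at this
    omega
  rw [Finset.mem_Icc] at hj
  have hmj : ∑ i, m i < j := lt_of_le_of_ne hj.1 (hjt m hm)
  obtain ⟨a, ha, hmax⟩ := Finset.exists_max_image (t.filter fun a => ∑ i, a i < j)
    (fun a => ∑ i, a i) ⟨m, Finset.mem_filter.2 ⟨hm, hmj⟩⟩
  rw [Finset.mem_filter] at ha
  -- The upper end of the gap: the element of least rank above `j`, or `m + 1` if there is none.
  -- Every point between `a` and `b` is compatible with the whole chain.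
  obtain ⟨b, hjb, hab, hlow, hup⟩ : ∃ b : Fin n → ℤ, j ≤ ∑ i, b i ∧ a ≤ b ∧
      (∀ d ∈ t, ∑ i, d i < j → b ≤ d + 1) ∧ (∀ d ∈ t, j < ∑ i, d i → b ≤ d) := by
    rcases (t.filter fun a => j < ∑ i, a i).eq_empty_or_nonempty with hemp | hnon
    · refine ⟨m + 1, ?_, (hmin a ha.1).2, fun d hd _ i => ?_, fun d hd hjd => ?_⟩
      · simpa [Finset.sum_add_distrib] using hj.2
      · have := (hmin d hd).1 i
        simpa using this
      · exact absurd (hemp ▸ Finset.mem_filter.2 ⟨hd, hjd⟩ : d ∈ (∅ : Finset (Fin n → ℤ)))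
          (Finset.notMem_empty d)
    · obtain ⟨b, hb, hbmin⟩ := Finset.exists_min_image _ (fun a => ∑ i, a i) hnon
      rw [Finset.mem_filter] at hb
      refine ⟨b, hb.2.le, (ht.le_of_sum_le ha.1 hb.1 (by linarith [ha.2, hb.2])).1,
        fun d hd hdj => (ht.le_of_sum_le hd hb.1 (by linarith [hb.2])).2, fun d hd hjd => ?_⟩
      exact (ht.le_of_sum_le hb.1 hd (hbmin d (Finset.mem_filter.2 ⟨hd, hjd⟩))).1
  obtain ⟨i, hi⟩ : ∃ i, a i < b i := by
    by_contra! hcon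
    have := Finset.sum_le_sum fun i (_ : i ∈ Finset.univ) => hcon i
    linarith [ha.2]
  -- One unit step from `a` towards `b`. Its rank is at most `j`, hence less than `j` if it belonged
  -- to `t`, which the maximality of `a` excludes.
  set c : Fin n → ℤ := a + Pi.single i 1 with hc
  have hsum : ∑ k, c k = ∑ k, a k + 1 := by
    simp [hc, Finset.sum_add_distrib]
  have hac : a ≤ c := by
    intro k
    by_cases hk : k = i
    · subst hk; simp [hc]
    · simp [hc, hk]
  have hcb : c ≤ b := by
    intro k
    by_cases hk : k = i
    · subst hk; simpa [hc] using hi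
    · simpa [hc, hk] using hab k
  have hct : ∀ d ∈ t, (d ≤ c ∧ c ≤ d + 1) ∨ (c ≤ d ∧ d ≤ c + 1) := by
    intro d hd
    rcases lt_or_gt_of_ne (hjt d hd) with hdj | hdj
    · left
      exact ⟨(ht.le_of_sum_le hd ha.1 (hmax d (Finset.mem_filter.2 ⟨hd, hdj⟩))).1.trans hac,
        hcb.trans (hlow d hd hdj)⟩
    · right
      refine ⟨hcb.trans (hup d hd hdj), ?_⟩
      refine (ht.le_of_sum_le ha.1 hd (by linarith [ha.2])).2.trans fun k => ?_
      simpa using hac k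
  refine ⟨c, fun hcmem => ?_, ?_⟩
  · have h1 : ∑ k, c k < j := lt_of_le_of_ne (by linarith [ha.2]) (hjt c hcmem)
    have := hmax c (Finset.mem_filter.2 ⟨hcmem, h1⟩)
    linarith
  · intro d hd e he
    rcases Finset.mem_insert.1 hd with rfl | hd
    · rcases Finset.mem_insert.1 he with rfl | he
      · exact Or.inl ⟨le_refl _, fun k => by simp⟩
      · exact (hct e he).symm
    · rcases Finset.mem_insert.1 he with rfl | he
      · exact hct d hd
      · exact ht d hd e he

lemma IsKuhnChain.exists_card_eq {t : Finset (Fin n → ℤ)} (ht : IsKuhnChain t)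
    (hne : t.Nonempty) : ∃ t', t ⊆ t' ∧ IsKuhnChain t' ∧ t'.card = n + 1 := by
  classical
  induction hk : n + 1 - t.card generalizing t with
  | zero => exact ⟨t, subset_rfl, ht, by have := ht.card_le; omega⟩
  | succ k ih =>
    obtain ⟨c, hc, hct⟩ := ht.exists_insert hne (by omega)
    obtain ⟨t', h1, h2, h3⟩ := ih hct (Finset.insert_nonempty _ _)
      (by rw [Finset.card_insert_of_notMem hc]; omega)
    exact ⟨t', (Finset.subset_insert _ _).trans h1, h2, h3⟩

lemma integral_gridPoint_shiftFloor {r : ℝ} (hr : 0 < r) (h x : EuclideanSpace ℝ (Fin n)) :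
    ∫ θ in Set.Ico (0 : ℝ) 1, gridPoint r h (shiftFloor (r⁻¹ • (x - h)) θ) = x := by
  ext i
  have hint := integrableOn_comp_shiftFloor (gridPoint r h) (r⁻¹ • (x - h))
  have := (EuclideanSpace.proj (𝕜 := ℝ) i : EuclideanSpace ℝ (Fin n) →L[ℝ] ℝ).integral_comp_comm
    hint
  simp only [EuclideanSpace.coe_proj, gridPoint_apply] at this
  rw [← this, integral_add, integral_const_mul]
  · simp only [shiftFloor]
    rw [integral_floor_add]
    simp
    field_simp
    ring
  · exact integrableOn_comp_shiftFloor (fun z => r * (z i : ℝ)) (r⁻¹ • (x - h))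
  · simp

/-- The values of `⌊y + θ⌋` form a Kuhn chain because they increase with `θ` by at most one in each
coordinate. Their average is `y`, so `x` lies in the closed convex hull of the corresponding
vertices. -/
lemma mem_kuhnComplex_space {r : ℝ} (hr : 0 < r) (h x : EuclideanSpace ℝ (Fin n)) :
    x ∈ (kuhnComplex r hr h).space := by
  classical
  set y := r⁻¹ • (x - h) with hy
  have hfin : (shiftFloor y '' Set.Ico (0 : ℝ) 1).Finite :=
    (Set.finite_Icc (shiftFloor y 0) (shiftFloor y 0 + 1)).subset
      (Set.image_subset_iff.2 fun θ hθ => shiftFloor_mem_Icc y hθ)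
  set t := hfin.toFinset with ht
  have hchain : IsKuhnChain t := by
    intro a ha b hb
    obtain ⟨s, hs, rfl⟩ := hfin.mem_toFinset.1 ha
    obtain ⟨s', hs', rfl⟩ := hfin.mem_toFinset.1 hb
    rcases le_total s s' with hle | hle
    · exact Or.inl ⟨shiftFloor_mono y hle, shiftFloor_le_add_one y (by linarith [hs.1, hs'.2])⟩
    · exact Or.inr ⟨shiftFloor_mono y hle, shiftFloor_le_add_one y (by linarith [hs'.1, hs.2])⟩
  have hne : t.Nonempty := ⟨shiftFloor y 0, hfin.mem_toFinset.2 ⟨0, by simp, rfl⟩⟩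
  refine Geometry.SimplicialComplex.mem_space_iff.2
    ⟨t.map ⟨gridPoint r h, gridPoint_injective hr h⟩, ⟨t, hne, hchain, rfl⟩, ?_⟩
  have : IsProbabilityMeasure (volume.restrict (Set.Ico (0 : ℝ) 1)) := ⟨by simp⟩
  have hclosed : IsClosed (convexHull ℝ ((t.map ⟨gridPoint r h, gridPoint_injective hr h⟩ :
      Finset (EuclideanSpace ℝ (Fin n))) : Set (EuclideanSpace ℝ (Fin n)))) :=
    (Finset.finite_toSet _).isClosed_convexHull ℝ
  have := (convex_convexHull ℝ _).integral_mem (μ := volume.restrict (Set.Ico (0 : ℝ) 1)) hclosed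
    (f := fun θ => gridPoint r h (shiftFloor y θ)) ?_
    (integrableOn_comp_shiftFloor (gridPoint r h) y)
  · rwa [integral_gridPoint_shiftFloor hr h x] at this
  · refine (ae_restrict_iff' measurableSet_Ico).2 (Eventually.of_forall fun θ hθ => ?_)
    refine subset_convexHull ℝ _ ?_
    exact Finset.mem_coe.2 (Finset.mem_map_of_mem _ (hfin.mem_toFinset.2 ⟨θ, hθ, rfl⟩))

/-- Used for local finiteness: a simplex that meets a ball has all its vertices in a slightly larger
box. -/
lemma abs_sub_gridPoint_le {r : ℝ} (hr : 0 < r) (h : EuclideanSpace ℝ (Fin n))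
    {t : Finset (Fin n → ℤ)} (ht : IsKuhnChain t) {x : EuclideanSpace ℝ (Fin n)}
    (hx : x ∈ convexHull ℝ ((t.map ⟨gridPoint r h, gridPoint_injective hr h⟩ :
      Finset (EuclideanSpace ℝ (Fin n))) : Set (EuclideanSpace ℝ (Fin n))))
    {a : Fin n → ℤ} (ha : a ∈ t) (i : Fin n) : |x i - (r * a i + h i)| ≤ r := by
  obtain ⟨w, h0, h1, rfl⟩ := (mem_convexHull_map_gridPoint hr h).1 hx
  have : (∑ a ∈ t, w a • gridPoint r h a) i - (r * a i + h i)
      = ∑ b ∈ t, w b * (r * ((b i : ℝ) - a i)) := by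
    have h2 : r * (a i : ℝ) + h i = ∑ b ∈ t, w b * (r * a i + h i) := by
      rw [← Finset.sum_mul, h1, one_mul]
    rw [h2]
    simp only [WithLp.ofLp_sum, WithLp.ofLp_smul, Finset.sum_apply, Pi.smul_apply, gridPoint_apply,
      smul_eq_mul]
    rw [← Finset.sum_sub_distrib]
    exact Finset.sum_congr rfl fun b _ => by ring
  rw [this]
  refine (Finset.abs_sum_le_sum_abs _ _).trans ?_
  calc ∑ b ∈ t, |w b * (r * ((b i : ℝ) - a i))| ≤ ∑ b ∈ t, w b * r := by
        refine Finset.sum_le_sum fun b hb => ?_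
        have hd : |(b i : ℝ) - a i| ≤ 1 := by
          rw [abs_le]
          rcases ht a ha b hb with ⟨e1, e2⟩ | ⟨e1, e2⟩
          · have e1 : (a i : ℝ) ≤ b i := by exact_mod_cast e1 i
            have e2 : (b i : ℝ) ≤ a i + 1 := by exact_mod_cast e2 i
            constructor <;> linarith
          · have e1 : (b i : ℝ) ≤ a i := by exact_mod_cast e1 i
            have e2 : (a i : ℝ) ≤ b i + 1 := by exact_mod_cast e2 i
            constructor <;> linarith
        rw [abs_mul, abs_mul, abs_of_nonneg (h0 b hb), abs_of_pos hr]
        exact mul_le_mul_of_nonneg_left (mul_le_of_le_one_right hr.le hd) (h0 b hb)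
    _ = r := by rw [← Finset.sum_mul, h1, one_mul]

lemma isTriangulation_kuhnComplex {r : ℝ} (hr : 0 < r) (h : EuclideanSpace ℝ (Fin n)) :
    IsTriangulation (kuhnComplex r hr h) where
  space_eq := Set.eq_univ_of_forall fun x => mem_kuhnComplex_space hr h x
  pure := by
    rintro s ⟨t, hne, ht, rfl⟩
    obtain ⟨t', h1, h2, h3⟩ := ht.exists_card_eq hne
    exact ⟨_, ⟨t', hne.mono h1, h2, rfl⟩, Finset.map_subset_map.2 h1, by simpa using h3⟩
  locallyFinite := by
    classical
    intro x
    refine ⟨Metric.ball x 1, Metric.ball_mem_nhds x one_pos, ?_⟩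
    set lo : Fin n → ℤ := fun i => ⌊r⁻¹ * (x i - h i - 1 - r)⌋
    set hi : Fin n → ℤ := fun i => ⌈r⁻¹ * (x i - h i + 1 + r)⌉
    have hfin : {s : Finset (EuclideanSpace ℝ (Fin n)) | s ∈ ((Finset.Icc lo hi).powerset.image
        fun t => t.map ⟨gridPoint r h, gridPoint_injective hr h⟩)}.Finite := Finset.finite_toSet _
    refine Set.Finite.of_finite_image (f := Subtype.val) (hfin.subset ?_)
      Subtype.val_injective.injOn
    rintro _ ⟨⟨s, t, hne, ht, rfl⟩, ⟨p, hp, hpx⟩, rfl⟩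
    refine Finset.mem_image.2 ⟨t, Finset.mem_powerset.2 fun a ha => ?_, rfl⟩
    have hpi : ∀ i, |p i - x i| ≤ 1 := fun i => by
      have h1 := PiLp.norm_apply_le (p - x) i
      rw [PiLp.sub_apply, Real.norm_eq_abs] at h1
      rw [Metric.mem_ball, dist_eq_norm] at hpx
      linarith
    have hai := fun i => abs_sub_gridPoint_le hr h ht hp ha i
    refine Finset.mem_Icc.2 ⟨fun i => ?_, fun i => ?_⟩
    · have : r⁻¹ * (x i - h i - 1 - r) ≤ a i := by
        rw [inv_mul_le_iff₀ hr]
        linarith [(abs_le.1 (hpi i)).1, (abs_le.1 (hai i)).2]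
      exact Int.cast_le.1 ((Int.floor_le _).trans this)
    · have : (a i : ℝ) ≤ r⁻¹ * (x i - h i + 1 + r) := by
        rw [le_inv_mul_iff₀ hr]
        linarith [(abs_le.1 (hpi i)).2, (abs_le.1 (hai i)).1]
      exact Int.cast_le.1 (this.trans (Int.le_ceil _))

lemma isDilatedTranslate_kuhnComplex {r : ℝ} (hr : 0 < r) (h : EuclideanSpace ℝ (Fin n)) :
    IsDilatedTranslate (kuhnComplex 1 one_pos 0) (kuhnComplex r hr h) r h := by
  classical
  have hcomp : ∀ z, r • gridPoint 1 (0 : EuclideanSpace ℝ (Fin n)) z + h = gridPoint r h z := by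
    intro z
    simp [gridPoint]
  intro s
  constructor
  · rintro ⟨t, hne, ht, rfl⟩
    refine ⟨_, ⟨t, hne, ht, rfl⟩, ?_⟩
    simp only [Finset.coe_map, Function.Embedding.coeFn_mk, Set.image_image, hcomp]
  · rintro ⟨_, ⟨t, hne, ht, rfl⟩, hs⟩
    refine ⟨t, hne, ht, Finset.coe_injective ?_⟩
    rw [hs]
    simp only [Finset.coe_map, Function.Embedding.coeFn_mk, Set.image_image, hcomp]

lemma IsKuhnChain.image_add {t : Finset (Fin n → ℤ)} (ht : IsKuhnChain t) (v : Fin n → ℤ) :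
    IsKuhnChain (t.map (addRightEmbedding v)) := by
  intro a ha b hb
  obtain ⟨a, ha', rfl⟩ := Finset.mem_map.1 ha
  obtain ⟨b, hb', rfl⟩ := Finset.mem_map.1 hb
  simp only [addRightEmbedding_apply, add_right_comm _ v 1, add_le_add_iff_right]
  exact ht a ha' b hb'

lemma isPeriodicComplex_kuhnComplex : IsPeriodicComplex (kuhnComplex (n := n) 1 one_pos 0) := by
  classical
  refine ⟨(EuclideanSpace.basisFun (Fin n) ℝ).toBasis, fun i s => ?_⟩
  have hcomp : ∀ z : Fin n → ℤ, (1 : ℝ) • gridPoint 1 (0 : EuclideanSpace ℝ (Fin n)) z +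
      (EuclideanSpace.basisFun (Fin n) ℝ).toBasis i = gridPoint 1 0 (z + Pi.single i 1) := by
    intro z
    ext k
    by_cases hk : k = i
    · subst hk; simp
    · simp [hk]
  constructor
  · rintro ⟨t, hne, ht, rfl⟩
    refine ⟨_, ⟨_, hne.map, ht.image_add (-Pi.single i 1), rfl⟩, ?_⟩
    simp only [Finset.coe_map, Function.Embedding.coeFn_mk, Set.image_image, hcomp]
    simp
  · rintro ⟨_, ⟨t, hne, ht, rfl⟩, hs⟩
    refine ⟨_, hne.map, ht.image_add (Pi.single i 1), Finset.coe_injective ?_⟩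
    rw [hs]
    simp only [Finset.coe_map, Function.Embedding.coeFn_mk, Set.image_image, hcomp,
      addRightEmbedding_apply]

lemma mem_kuhnComplex_vertices {r : ℝ} (hr : 0 < r) (h a : EuclideanSpace ℝ (Fin n)) :
    a ∈ (kuhnComplex r hr h).vertices ↔ ∃ z, a = gridPoint r h z := by
  classical
  constructor
  · rintro ⟨t, hne, ht, hat⟩
    have : a ∈ ({a} : Finset (EuclideanSpace ℝ (Fin n))) := Finset.mem_singleton_self a
    rw [hat] at this
    obtain ⟨z, -, rfl⟩ := Finset.mem_map.1 this
    exact ⟨z, rfl⟩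
  · rintro ⟨z, rfl⟩
    refine ⟨{z}, Finset.singleton_nonempty z, fun b hb d hd => ?_, by simp⟩
    rw [Finset.mem_singleton] at hb hd
    subst hb hd
    exact Or.inl ⟨le_refl _, fun k => by simp⟩

/-- `kuhnInterp` is the Lagrange interpolant on the Kuhn triangulation. -/
lemma isLagrangeInterpolant_kuhnInterp {r : ℝ} (hr : 0 < r) (h : EuclideanSpace ℝ (Fin n))
    (u : EuclideanSpace ℝ (Fin n) → ℝ) :
    IsLagrangeInterpolant (kuhnComplex r hr h) u
      (kuhnInterp r h fun z => u (gridPoint r h z)) where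
  affine_on := by
    classical
    rintro _ ⟨t, hne, ht, rfl⟩
    -- A face is enlarged to a simplex with `n + 1` vertices, whose barycentric coordinates are
    -- affine functions on all of the space.
    obtain ⟨t', htt', ht', hcard⟩ := ht.exists_card_eq hne
    have hind := affineIndependent_gridPoint hr h ht'
    have hspan : affineSpan ℝ (Set.range fun a : t' => gridPoint r h a) = ⊤ := by
      refine (hind.affineSpan_eq_top_iff_card_eq_finrank_add_one).2 ?_
      simpa using hcard
    let B : AffineBasis t' ℝ (EuclideanSpace ℝ (Fin n)) := ⟨_, hind, hspan⟩
    let A : EuclideanSpace ℝ (Fin n) →ᵃ[ℝ] ℝ :=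
      (Fintype.linearCombination ℝ fun a : t' => u (gridPoint r h a)).toAffineMap.comp B.coords
    have hA : ∀ a ∈ t', A (gridPoint r h a) = u (gridPoint r h a) := by
      intro a ha
      have hB : gridPoint r h a = B ⟨a, ha⟩ := rfl
      have : A (gridPoint r h a) = ∑ b : t', B.coord b (gridPoint r h a) * u (gridPoint r h b) := by
        simp [A, Fintype.linearCombination_apply]
      rw [this]
      conv_lhs => rw [hB]
      simp only [AffineBasis.coord_apply, ite_mul, one_mul, zero_mul]
      rw [Finset.sum_ite_eq' Finset.univ (⟨a, ha⟩ : t') (fun b => u (gridPoint r h b))]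
      simp
    refine ⟨A, fun x hx => ?_⟩
    obtain ⟨w, h0, h1, rfl⟩ := (mem_convexHull_map_gridPoint hr h).1 hx
    rw [kuhnInterp_convexCombination hr h ht h0 h1]
    have := t.map_affineCombination (fun a => gridPoint r h a) w h1 A
    rw [t.affineCombination_eq_linear_combination _ _ h1,
      t.affineCombination_eq_linear_combination _ _ h1] at this
    rw [this]
    exact Finset.sum_congr rfl fun a ha => by simp [hA a (htt' ha)]
  eq_on_vertices := by
    intro a ha
    obtain ⟨z, rfl⟩ := (mem_kuhnComplex_vertices hr h a).1 ha
    have hchain : IsKuhnChain ({z} : Finset (Fin n → ℤ)) := by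
      intro b hb d hd
      rw [Finset.mem_singleton] at hb hd
      subst hb hd
      exact Or.inl ⟨le_refl _, fun k => by simp⟩
    have := kuhnInterp_convexCombination hr h hchain (w := fun _ => 1) (by simp) (by simp)
      (fun z => u (gridPoint r h z))
    simpa using this

end KuhnTriangulation

/-! ### The gradient of the interpolant -/

/-- The first of the integer points `⌊y + θ⌋`, `0 ≤ θ ≤ 1`, whose `i`-th coordinate exceeds that
of `⌊y⌋`, where `y = (x - h) / r`. -/
noncomputable def kuhnJump {n : ℕ} (r : ℝ) (h x : EuclideanSpace ℝ (Fin n)) (i : Fin n) :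
    Fin n → ℤ :=
  shiftFloor (r⁻¹ • (x - h)) (1 - Int.fract ((r⁻¹ • (x - h)) i))

/-- The gradient of `kuhnInterp`: its partial derivatives are difference quotients of `c` along the
edges of the simplex. -/
noncomputable def kuhnGrad {n : ℕ} (r : ℝ) (h : EuclideanSpace ℝ (Fin n))
    (c : (Fin n → ℤ) → ℝ) (x : EuclideanSpace ℝ (Fin n)) : EuclideanSpace ℝ (Fin n) →L[ℝ] ℝ :=
  ∑ i, (r⁻¹ * (c (kuhnJump r h x i) - c (kuhnJump r h x i - Pi.single i 1))) •
    EuclideanSpace.proj i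

section KuhnGradient

variable {n : ℕ}

lemma integral_abs_floor_sub_le (s t : ℝ) :
    ∫ θ in Set.Ico (0 : ℝ) 1, |(⌊s + θ⌋ : ℝ) - ⌊t + θ⌋| = |s - t| := by
  have hint : ∀ a : ℝ, IntegrableOn (fun θ : ℝ => (⌊a + θ⌋ : ℝ)) (Set.Ico (0 : ℝ) 1) := fun a =>
    integrableOn_comp_shiftFloor (n := 1) (fun z => (z 0 : ℝ)) (WithLp.toLp 2 fun _ => a)
  wlog hst : s ≤ t generalizing s t with H
  · have := H t s (le_of_not_ge hst)
    rw [abs_sub_comm, ← this]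
    exact integral_congr_ae (Eventually.of_forall fun θ => abs_sub_comm _ _)
  have : ∀ θ : ℝ, |(⌊s + θ⌋ : ℝ) - ⌊t + θ⌋| = ⌊t + θ⌋ - ⌊s + θ⌋ := fun θ => by
    have h1 : (⌊s + θ⌋ : ℝ) ≤ ⌊t + θ⌋ := by
      exact_mod_cast Int.floor_le_floor (by linarith)
    rw [abs_of_nonpos (by linarith)]
    ring
  simp_rw [this]
  rw [integral_sub (hint t) (hint s), integral_floor_add, integral_floor_add, abs_of_nonpos
    (by linarith)]
  ring

/-- The integrands differ only for those `θ` at which some coordinate floor differs, and then by at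
most `2 M`. The mean of each floor difference is the distance between the coordinates. -/
lemma abs_kuhnInterp_sub_le {r : ℝ} (hr : 0 < r) (h : EuclideanSpace ℝ (Fin n))
    {c : (Fin n → ℤ) → ℝ} {M : ℝ} (hM : ∀ z, |c z| ≤ M) (x x' : EuclideanSpace ℝ (Fin n)) :
    |kuhnInterp r h c x - kuhnInterp r h c x'| ≤ 2 * M * n * r⁻¹ * ‖x - x'‖ := by
  have hM0 : 0 ≤ M := (abs_nonneg _).trans (hM 0)
  set y := r⁻¹ • (x - h)
  set y' := r⁻¹ • (x' - h)
  have hpt : ∀ θ, |c (shiftFloor y θ) - c (shiftFloor y' θ)| ≤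
      2 * M * ∑ i, |(⌊y i + θ⌋ : ℝ) - ⌊y' i + θ⌋| := by
    intro θ
    by_cases heq : shiftFloor y θ = shiftFloor y' θ
    · rw [heq, sub_self, abs_zero]
      positivity
    · obtain ⟨i, hi⟩ := Function.ne_iff.1 heq
      have h1 : (1 : ℝ) ≤ |(⌊y i + θ⌋ : ℝ) - ⌊y' i + θ⌋| := by
        have : (1 : ℤ) ≤ |⌊y i + θ⌋ - ⌊y' i + θ⌋| := Int.one_le_abs (sub_ne_zero.2 hi)
        exact_mod_cast this
      have h2 : |(⌊y i + θ⌋ : ℝ) - ⌊y' i + θ⌋| ≤ ∑ i, |(⌊y i + θ⌋ : ℝ) - ⌊y' i + θ⌋| :=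
        Finset.single_le_sum (f := fun i => |(⌊y i + θ⌋ : ℝ) - ⌊y' i + θ⌋|)
          (fun _ _ => abs_nonneg _) (Finset.mem_univ i)
      calc |c (shiftFloor y θ) - c (shiftFloor y' θ)| ≤ |c (shiftFloor y θ)| + |c (shiftFloor y' θ)| :=
            abs_sub _ _
        _ ≤ 2 * M * 1 := by linarith [hM (shiftFloor y θ), hM (shiftFloor y' θ)]
        _ ≤ _ := by gcongr; linarith
  have hint : ∀ i, IntegrableOn (fun θ : ℝ => |(⌊y i + θ⌋ : ℝ) - ⌊y' i + θ⌋|) (Set.Ico (0 : ℝ) 1) :=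
    fun i => ((integrableOn_comp_shiftFloor (fun z => (z i : ℝ)) y).sub
      (integrableOn_comp_shiftFloor (fun z => (z i : ℝ)) y')).norm
  have hsum : IntegrableOn (fun θ => 2 * M * ∑ i, |(⌊y i + θ⌋ : ℝ) - ⌊y' i + θ⌋|)
      (Set.Ico (0 : ℝ) 1) := (integrable_finsetSum _ fun i _ => hint i).const_mul _
  calc |kuhnInterp r h c x - kuhnInterp r h c x'|
      = ‖∫ θ in Set.Ico (0 : ℝ) 1, (c (shiftFloor y θ) - c (shiftFloor y' θ))‖ := by
        rw [integral_sub (integrableOn_comp_shiftFloor c y) (integrableOn_comp_shiftFloor c y')]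
        rfl
    _ ≤ ∫ θ in Set.Ico (0 : ℝ) 1, 2 * M * ∑ i, |(⌊y i + θ⌋ : ℝ) - ⌊y' i + θ⌋| :=
        norm_integral_le_of_norm_le hsum (Eventually.of_forall hpt)
    _ = 2 * M * ∑ i, |y i - y' i| := by
        rw [integral_const_mul, integral_finsetSum _ fun i _ => hint i]
        simp_rw [integral_abs_floor_sub_le]
    _ ≤ 2 * M * ∑ _i : Fin n, r⁻¹ * ‖x - x'‖ := by
        gcongr with i
        have : y i - y' i = r⁻¹ * (x - x') i := by
          simp [y, y']
          ring
        rw [this, abs_mul, abs_of_pos (inv_pos.2 hr)]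
        gcongr
        exact PiLp.norm_apply_le (x - x') i
    _ = _ := by
        simp
        ring

lemma lipschitzWith_kuhnInterp {r : ℝ} (hr : 0 < r) (h : EuclideanSpace ℝ (Fin n))
    {c : (Fin n → ℤ) → ℝ} {M : ℝ} (hM : ∀ z, |c z| ≤ M) :
    LipschitzWith (2 * M * n * r⁻¹).toNNReal (kuhnInterp r h c) :=
  LipschitzWith.of_dist_le' fun x x' => by
    rw [Real.dist_eq, dist_eq_norm]
    exact abs_kuhnInterp_sub_le hr h hM x x'

/-- Away from ties between coordinates, the increment of the interpolant in a coordinate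
direction involves a single edge. -/
lemma integral_comp_shiftFloor_add_single (c : (Fin n → ℤ) → ℝ) (y : EuclideanSpace ℝ (Fin n))
    (i : Fin n) (hy : ∀ j ≠ i, ∀ m : ℤ, y j - y i ≠ m) :
    ∀ᶠ t in 𝓝[>] (0 : ℝ),
      (∫ θ in Set.Ico (0 : ℝ) 1, c (shiftFloor (y + t • EuclideanSpace.single i (1 : ℝ)) θ)) -
        ∫ θ in Set.Ico (0 : ℝ) 1, c (shiftFloor y θ) =
      t * (c (shiftFloor y (1 - Int.fract (y i))) -
        c (shiftFloor y (1 - Int.fract (y i)) - Pi.single i 1)) := by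
  -- `τ` is the time at which the `i`-th coordinate of `⌊y + θ⌋` jumps. By the hypothesis on ties no
  -- other `y j + τ` is an integer, so for small `t` no other coordinate jumps during `[τ - t, τ)`.
  -- Moving `y` by `t` in direction `i` advances the jump to `τ - t`, which changes the integrand on
  -- that interval only.
  set τ := 1 - Int.fract (y i) with hτ
  have hτ0 : 0 < τ := by linarith [Int.fract_lt_one (y i)]
  have hτ1 : τ ≤ 1 := by linarith [Int.fract_nonneg (y i)]
  have hyi : y i + τ = ⌊y i⌋ + 1 := by rw [hτ, Int.fract]; ring
  have hfr : ∀ j ≠ i, 0 < Int.fract (y j + τ) := by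
    intro j hj
    refine lt_of_le_of_ne (Int.fract_nonneg _) fun h0 => ?_
    rw [Int.fract, eq_comm, sub_eq_zero] at h0
    refine hy j hj (⌊y j + τ⌋ - ⌊y i⌋ - 1) ?_
    push_cast
    linarith
  have hev : ∀ᶠ t in 𝓝[>] (0 : ℝ), ∀ j ≠ i, t < Int.fract (y j + τ) := by
    rw [eventually_all]
    intro j
    by_cases hj : j = i
    · exact Eventually.of_forall fun t h => absurd hj h
    · filter_upwards [Ioo_mem_nhdsGT (hfr j hj)] with t ht _ using ht.2
  filter_upwards [hev, Ioo_mem_nhdsGT hτ0] with t htj ht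
  set b := shiftFloor y τ with hb
  have hbi : b i = ⌊y i⌋ + 1 := by
    simp only [hb, shiftFloor, hyi]
    rw [Int.floor_add_one, Int.floor_intCast]
  have hi : (y + t • EuclideanSpace.single i (1 : ℝ)) i = y i + t := by simp
  have hne : ∀ j ≠ i, (y + t • EuclideanSpace.single i (1 : ℝ)) j = y j := fun j hj => by simp [hj]
  have hout : ∀ θ ∈ Set.Ico (0 : ℝ) 1, θ ∉ Set.Ico (τ - t) τ →
      shiftFloor (y + t • EuclideanSpace.single i (1 : ℝ)) θ = shiftFloor y θ := by
    intro θ hθ hnot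
    funext j
    by_cases hj : j = i
    · subst hj
      simp only [shiftFloor, hi]
      have hfl := Int.floor_le (y j)
      by_cases hlt : θ < τ
      · have hlt2 : θ < τ - t := by
          by_contra hcon
          exact hnot ⟨not_lt.1 hcon, hlt⟩
        have h1 : ⌊y j + t + θ⌋ = ⌊y j⌋ :=
          Int.floor_eq_iff.2 ⟨by linarith [hθ.1, ht.1], by linarith⟩
        have h2 : ⌊y j + θ⌋ = ⌊y j⌋ := Int.floor_eq_iff.2 ⟨by linarith [hθ.1], by linarith⟩
        rw [h1, h2]
      · rw [not_lt] at hlt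
        have h1 : ⌊y j + t + θ⌋ = ⌊y j⌋ + 1 := Int.floor_eq_iff.2
          ⟨by push_cast; linarith [ht.1], by push_cast; linarith [hθ.2, ht.2]⟩
        have h2 : ⌊y j + θ⌋ = ⌊y j⌋ + 1 := Int.floor_eq_iff.2
          ⟨by push_cast; linarith, by push_cast; linarith [hθ.2, Int.lt_floor_add_one (y j)]⟩
        rw [h1, h2]
    · simp only [shiftFloor, hne j hj]
  have hin : ∀ θ ∈ Set.Ico (τ - t) τ,
      shiftFloor (y + t • EuclideanSpace.single i (1 : ℝ)) θ = b ∧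
        shiftFloor y θ = b - Pi.single i 1 := by
    intro θ hθ
    have hfl := Int.floor_le (y i)
    have key : ∀ j ≠ i, ⌊y j + θ⌋ = ⌊y j + τ⌋ := by
      intro j hj
      have h1 := htj j hj
      have h2 := Int.lt_floor_add_one (y j + τ)
      rw [Int.fract] at h1
      exact Int.floor_eq_iff.2 ⟨by linarith [hθ.1], by linarith [hθ.2]⟩
    constructor
    · funext j
      by_cases hj : j = i
      · subst hj
        rw [hbi]
        simp only [shiftFloor, hi]
        exact Int.floor_eq_iff.2 ⟨by push_cast; linarith [hθ.1], by
          push_cast; linarith [hθ.2, ht.2]⟩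
      · simp only [shiftFloor, hne j hj, key j hj, hb]
    · funext j
      by_cases hj : j = i
      · subst hj
        rw [Pi.sub_apply, hbi, Pi.single_eq_same, add_sub_cancel_right]
        exact Int.floor_eq_iff.2 ⟨by linarith [hθ.1, ht.2], by linarith [hθ.2]⟩
      · simp only [shiftFloor, key j hj, hb, Pi.sub_apply, Pi.single_eq_of_ne hj, sub_zero]
  rw [← integral_sub (integrableOn_comp_shiftFloor c _) (integrableOn_comp_shiftFloor c _)]
  have hsub : Set.Ico (τ - t) τ ⊆ Set.Ico (0 : ℝ) 1 :=
    Set.Ico_subset_Ico (by linarith [ht.2]) hτ1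
  rw [setIntegral_eq_of_subset_of_forall_sdiff_eq_zero measurableSet_Ico hsub
    fun θ hθ => by rw [hout θ hθ.1 hθ.2, sub_self]]
  rw [setIntegral_congr_fun (g := fun _ => c b - c (b - Pi.single i 1)) measurableSet_Ico
    fun θ hθ => by simp only [(hin θ hθ).1, (hin θ hθ).2]]
  rw [setIntegral_const, Real.volume_real_Ico, sub_sub_cancel, max_eq_left ht.1.le, smul_eq_mul]

lemma ae_sub_ne {i j : Fin n} (hij : j ≠ i) (a : ℝ) :
    ∀ᵐ x : EuclideanSpace ℝ (Fin n), x j - x i ≠ a := by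
  let A : AffineSubspace ℝ (EuclideanSpace ℝ (Fin n)) :=
    { carrier := {x | x j - x i = a}
      smul_vsub_vadd_mem' := by
        intro s p q w hp hq hw
        simp only [Set.mem_ofPred_eq] at hp hq hw ⊢
        simp only [vsub_eq_sub, vadd_eq_add, PiLp.add_apply, PiLp.smul_apply, PiLp.sub_apply,
          smul_eq_mul]
        linear_combination s * hp - s * hq + hw }
  have hA : A ≠ ⊤ := by
    intro htop
    have : EuclideanSpace.single j (a + 1) ∈ A := by rw [htop]; exact AffineSubspace.mem_top _ _ _
    have h2 : (EuclideanSpace.single j (a + 1) : EuclideanSpace ℝ (Fin n)) j -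
      (EuclideanSpace.single j (a + 1) : EuclideanSpace ℝ (Fin n)) i = a := this
    simp [hij.symm] at h2
  have := Measure.addHaar_affineSubspace volume A hA
  rw [ae_iff]
  simp only [ne_eq, not_not]
  exact this

lemma kuhnGrad_single (r : ℝ) (h : EuclideanSpace ℝ (Fin n)) (c : (Fin n → ℤ) → ℝ)
    (x : EuclideanSpace ℝ (Fin n)) (i : Fin n) :
    kuhnGrad r h c x (EuclideanSpace.single i 1) =
      r⁻¹ * (c (kuhnJump r h x i) - c (kuhnJump r h x i - Pi.single i 1)) := by
  simp [kuhnGrad]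

lemma sum_smul_single (e : EuclideanSpace ℝ (Fin n)) :
    ∑ i, e i • EuclideanSpace.single i (1 : ℝ) = e := by
  ext k
  simp [Pi.single_apply]

/-- The interpolant is Lipschitz, so almost everywhere it has coordinate derivatives, and its
derivative along `e` is the corresponding linear combination. As the derivatives exist, right slopes
suffice to identify them; these are computed off the null set of ties. -/
lemma ae_lineDeriv_kuhnInterp {r : ℝ} (hr : 0 < r) (h : EuclideanSpace ℝ (Fin n))
    {c : (Fin n → ℤ) → ℝ} {M : ℝ} (hM : ∀ z, |c z| ≤ M) (e : EuclideanSpace ℝ (Fin n)) :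
    ∀ᵐ x, lineDeriv ℝ (kuhnInterp r h c) x e = kuhnGrad r h c x e := by
  have hL := lipschitzWith_kuhnInterp hr h hM
  have hgen : ∀ᵐ x : EuclideanSpace ℝ (Fin n), ∀ i j : Fin n, j ≠ i → ∀ m : ℤ,
      x j - x i ≠ r * m + h j - h i := by
    simp only [ae_all_iff]
    exact fun i j hij m => ae_sub_ne hij _
  have hdiff : ∀ᵐ x : EuclideanSpace ℝ (Fin n), ∀ i : Fin n,
      LineDifferentiableAt ℝ (kuhnInterp r h c) x (EuclideanSpace.single i (1 : ℝ)) :=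
    ae_all_iff.2 fun i => hL.ae_lineDifferentiableAt _
  filter_upwards [hgen, hdiff, hL.ae_lineDeriv_sum_eq (μ := volume) Finset.univ (fun i => e i)
    fun i => EuclideanSpace.single i (1 : ℝ)] with x hx hd hsum
  rw [sum_smul_single] at hsum
  rw [hsum]
  conv_rhs => rw [← sum_smul_single e, map_sum]
  refine Finset.sum_congr rfl fun i _ => ?_
  rw [map_smul, kuhnGrad_single]
  congr 1
  refine tendsto_nhds_unique (hd i).hasLineDerivAt.tendsto_slope_zero_right ?_
  have hinc := integral_comp_shiftFloor_add_single c (r⁻¹ • (x - h)) i (fun j hj m => by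
    intro heq
    refine hx i j hj m ?_
    simp only [PiLp.smul_apply, PiLp.sub_apply, smul_eq_mul] at heq
    field_simp at heq
    linarith)
  have htend : Tendsto (fun t : ℝ => r⁻¹ * t) (𝓝[>] 0) (𝓝[>] 0) := by
    refine tendsto_nhdsWithin_iff.2 ⟨?_, ?_⟩
    · have : Tendsto (fun t : ℝ => r⁻¹ * t) (𝓝 0) (𝓝 (r⁻¹ * 0)) :=
        (continuous_const.mul continuous_id).tendsto 0
      rw [mul_zero] at this
      exact this.mono_left nhdsWithin_le_nhds
    · filter_upwards [self_mem_nhdsWithin] with t ht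
      exact mul_pos (inv_pos.2 hr) ht
  refine tendsto_const_nhds.congr' ?_
  filter_upwards [htend.eventually hinc, self_mem_nhdsWithin] with t ht ht0
  have harg : r⁻¹ • (x + t • EuclideanSpace.single i (1 : ℝ) - h) =
      r⁻¹ • (x - h) + (r⁻¹ * t) • EuclideanSpace.single i (1 : ℝ) := by
    rw [mul_smul, ← smul_add]
    congr 1
    abel
  have hK : kuhnInterp r h c (x + t • EuclideanSpace.single i (1 : ℝ)) - kuhnInterp r h c x =
      (r⁻¹ * t) * (c (kuhnJump r h x i) - c (kuhnJump r h x i - Pi.single i 1)) := by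
    simp only [kuhnInterp, harg]
    exact ht
  rw [hK, smul_eq_mul]
  have : t ≠ 0 := ne_of_gt ht0
  field_simp

lemma measurable_kuhnJump (r : ℝ) (h : EuclideanSpace ℝ (Fin n)) (i : Fin n) :
    Measurable fun x => kuhnJump r h x i := by
  refine measurable_pi_lambda _ fun j => Int.measurable_floor.comp ?_
  have : ∀ j, Measurable fun x : EuclideanSpace ℝ (Fin n) => (r⁻¹ • (x - h)) j := fun j =>
    Continuous.measurable (by fun_prop)
  exact (this j).add (measurable_const.sub (measurable_fract.comp (this i)))

lemma stronglyMeasurable_kuhnGrad (r : ℝ) (h : EuclideanSpace ℝ (Fin n)) (c : (Fin n → ℤ) → ℝ) :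
    StronglyMeasurable (kuhnGrad r h c) := by
  refine Finset.stronglyMeasurable_fun_sum _ fun i _ => ?_
  refine StronglyMeasurable.smul_const ?_ _
  refine Measurable.stronglyMeasurable (measurable_const.mul ?_)
  exact (Measurable.of_discrete (f := fun z => c z - c (z - Pi.single i 1))).comp
    (measurable_kuhnJump r h i)

lemma norm_kuhnGrad_le {r : ℝ} (hr : 0 < r) (h : EuclideanSpace ℝ (Fin n))
    {c : (Fin n → ℤ) → ℝ} {M : ℝ} (hM : ∀ z, |c z| ≤ M) (x : EuclideanSpace ℝ (Fin n)) :
    ‖kuhnGrad r h c x‖ ≤ ∑ i : Fin n, r⁻¹ * (2 * M) *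
      ‖(EuclideanSpace.proj i : EuclideanSpace ℝ (Fin n) →L[ℝ] ℝ)‖ := by
  refine (norm_sum_le _ _).trans (Finset.sum_le_sum fun i _ => ?_)
  rw [norm_smul, norm_mul, Real.norm_of_nonneg (inv_nonneg.2 hr.le)]
  gcongr
  rw [Real.norm_eq_abs]
  refine (abs_sub _ _).trans ?_
  linarith [hM (kuhnJump r h x i), hM (kuhnJump r h x i - Pi.single i 1)]

/-- On a ball, the interpolant and its gradient only involve finitely many values of `c`. -/
lemma exists_bounded_kuhnInterp_eq {r : ℝ} (hr : 0 < r) (h : EuclideanSpace ℝ (Fin n))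
    (c : (Fin n → ℤ) → ℝ) (R : ℝ) : ∃ c' : (Fin n → ℤ) → ℝ, (∃ M, ∀ z, |c' z| ≤ M) ∧
      ∀ x ∈ Metric.ball (0 : EuclideanSpace ℝ (Fin n)) R,
        kuhnInterp r h c x = kuhnInterp r h c' x ∧ kuhnGrad r h c x = kuhnGrad r h c' x := by
  classical
  -- The extra `-1` makes room for the lower end `kuhnJump - Pi.single i 1` of an edge, and the `+1`
  -- in `hi` for `θ` up to and including 1, which `kuhnJump` uses when `y i` is an integer.
  set lo : Fin n → ℤ := fun i => ⌊r⁻¹ * (-R - h i)⌋ - 1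
  set hi : Fin n → ℤ := fun i => ⌊r⁻¹ * (R - h i)⌋ + 1
  set c' : (Fin n → ℤ) → ℝ := fun z => if z ∈ Finset.Icc lo hi then c z else 0 with hc'
  have hbox : ∀ x ∈ Metric.ball (0 : EuclideanSpace ℝ (Fin n)) R, ∀ θ ∈ Set.Icc (0 : ℝ) 1,
      ∀ i, lo i + 1 ≤ shiftFloor (r⁻¹ • (x - h)) θ i ∧ shiftFloor (r⁻¹ • (x - h)) θ i ≤ hi i := by
    intro x hx θ hθ i
    have h1 := PiLp.norm_apply_le x i
    rw [mem_ball_zero_iff] at hx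
    rw [Real.norm_eq_abs, abs_le] at h1
    have h3 : r⁻¹ * (-R - h i) ≤ (r⁻¹ • (x - h)) i := by
      simp only [PiLp.smul_apply, PiLp.sub_apply, smul_eq_mul]
      gcongr
      linarith
    have h4 : (r⁻¹ • (x - h)) i ≤ r⁻¹ * (R - h i) := by
      simp only [PiLp.smul_apply, PiLp.sub_apply, smul_eq_mul]
      gcongr
      linarith
    constructor
    · simp only [lo, sub_add_cancel]
      exact Int.floor_le_floor (by linarith [hθ.1])
    · simp only [hi, shiftFloor]
      rw [← Int.floor_add_one]
      exact Int.floor_le_floor (by linarith [hθ.2])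
  refine ⟨c', ⟨∑ z ∈ Finset.Icc lo hi, |c z|, fun z => ?_⟩, fun x hx => ⟨?_, ?_⟩⟩
  · by_cases hz : z ∈ Finset.Icc lo hi
    · simp only [hc', hz, if_true]
      exact Finset.single_le_sum (f := fun z => |c z|) (fun _ _ => abs_nonneg _) hz
    · simp only [hc', hz, if_false, abs_zero]
      exact Finset.sum_nonneg fun _ _ => abs_nonneg _
  · refine setIntegral_congr_fun measurableSet_Ico fun θ hθ => ?_
    have hb := hbox x hx θ ⟨hθ.1, hθ.2.le⟩
    simp only [hc']
    rw [if_pos (Finset.mem_Icc.2 ⟨fun i => by linarith [(hb i).1], fun i => (hb i).2⟩)]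
  · refine Finset.sum_congr rfl fun i _ => ?_
    have hb := hbox x hx (1 - Int.fract ((r⁻¹ • (x - h)) i))
      ⟨by linarith [Int.fract_lt_one ((r⁻¹ • (x - h)) i)],
        by linarith [Int.fract_nonneg ((r⁻¹ • (x - h)) i)]⟩
    have hm1 : kuhnJump r h x i ∈ Finset.Icc lo hi :=
      Finset.mem_Icc.2 ⟨fun j => by have := (hb j).1; simp only [kuhnJump]; linarith,
        fun j => (hb j).2⟩
    have hm2 : kuhnJump r h x i - Pi.single i 1 ∈ Finset.Icc lo hi := by
      refine Finset.mem_Icc.2 ⟨fun j => ?_, fun j => ?_⟩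
      · have := (hb j).1
        by_cases hj : j = i
        · subst hj
          simp only [kuhnJump, Pi.sub_apply, Pi.single_eq_same]
          linarith
        · simp only [kuhnJump, Pi.sub_apply, Pi.single_eq_of_ne hj]
          linarith
      · have := (hb j).2
        by_cases hj : j = i
        · subst hj
          simp only [kuhnJump, Pi.sub_apply, Pi.single_eq_same]
          linarith
        · simp only [kuhnJump, Pi.sub_apply, Pi.single_eq_of_ne hj]
          linarith
    simp only [hc', hm1, hm2, if_true]

lemma continuous_kuhnInterp {r : ℝ} (hr : 0 < r) (h : EuclideanSpace ℝ (Fin n))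
    (c : (Fin n → ℤ) → ℝ) : Continuous (kuhnInterp r h c) := by
  refine continuous_iff_continuousAt.2 fun x => ?_
  obtain ⟨c', ⟨M, hM⟩, heq⟩ := exists_bounded_kuhnInterp_eq hr h c (‖x‖ + 1)
  refine ((lipschitzWith_kuhnInterp hr h hM).continuous.continuousAt (x := x)).congr ?_
  filter_upwards [Metric.isOpen_ball.mem_nhds (mem_ball_zero_iff.2 (lt_add_one ‖x‖))] with z hz
  exact (heq z hz).1.symm

lemma locallyIntegrable_kuhnGrad {r : ℝ} (hr : 0 < r) (h : EuclideanSpace ℝ (Fin n))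
    (c : (Fin n → ℤ) → ℝ) : LocallyIntegrable (kuhnGrad r h c) := by
  intro x
  obtain ⟨c', ⟨M, hM⟩, heq⟩ := exists_bounded_kuhnInterp_eq hr h c (‖x‖ + 1)
  refine ⟨_, Metric.isOpen_ball.mem_nhds (mem_ball_zero_iff.2 (lt_add_one ‖x‖)), ?_⟩
  refine IntegrableOn.of_bound measure_ball_lt_top
    (stronglyMeasurable_kuhnGrad r h c).aestronglyMeasurable
    (∑ i : Fin n, r⁻¹ * (2 * M) * ‖(EuclideanSpace.proj i : EuclideanSpace ℝ (Fin n) →L[ℝ] ℝ)‖) ?_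
  refine (ae_restrict_iff' measurableSet_ball).2 (Eventually.of_forall fun z hz => ?_)
  rw [(heq z hz).2]
  exact norm_kuhnGrad_le hr h hM z

/-- On a ball containing the support of `φ` the data may be replaced by bounded data. The
interpolant is then globally Lipschitz and integration by parts applies. -/
lemma hasWeakDeriv_kuhnInterp {r : ℝ} (hr : 0 < r) (h : EuclideanSpace ℝ (Fin n))
    (c : (Fin n → ℤ) → ℝ) : HasWeakDeriv (kuhnInterp r h c) (kuhnGrad r h c) where
  locallyIntegrable := (continuous_kuhnInterp hr h c).locallyIntegrable
  locallyIntegrable_deriv := locallyIntegrable_kuhnGrad hr h c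
  integral_mul_fderiv := by
    intro φ hφ hφc e
    obtain ⟨R, hR⟩ := hφc.isCompact.isBounded.subset_ball (0 : EuclideanSpace ℝ (Fin n))
    obtain ⟨c', ⟨M, hM⟩, heq⟩ := exists_bounded_kuhnInterp_eq hr h c R
    have hzero : ∀ x ∉ Metric.ball (0 : EuclideanSpace ℝ (Fin n)) R, φ x = 0 ∧ fderiv ℝ φ x = 0 := by
      intro x hx
      have hx' : x ∉ tsupport φ := fun hmem => hx (hR hmem)
      exact ⟨image_eq_zero_of_notMem_tsupport hx', by
        rw [(notMem_tsupport_iff_eventuallyEq.1 hx').fderiv_eq]; simp⟩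
    have e1 : ∫ x, kuhnInterp r h c x * fderiv ℝ φ x e =
        ∫ x, kuhnInterp r h c' x * fderiv ℝ φ x e := by
      congr 1
      funext x
      by_cases hx : x ∈ Metric.ball (0 : EuclideanSpace ℝ (Fin n)) R
      · rw [(heq x hx).1]
      · rw [(hzero x hx).2]; simp
    have e2 : ∫ x, kuhnGrad r h c x e * φ x = ∫ x, kuhnGrad r h c' x e * φ x := by
      congr 1
      funext x
      by_cases hx : x ∈ Metric.ball (0 : EuclideanSpace ℝ (Fin n)) R
      · rw [(heq x hx).2]
      · rw [(hzero x hx).1]; simp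
    obtain ⟨D, hD⟩ : ∃ D, LipschitzWith D φ :=
      ContDiff.lipschitzWith_of_hasCompactSupport hφc hφ (by simp)
    have hparts := (lipschitzWith_kuhnInterp hr h hM).integral_lineDeriv_mul_eq (μ := volume)
      hD hφc e
    rw [e1, e2]
    have e3 : ∫ x, kuhnGrad r h c' x e * φ x =
        ∫ x, lineDeriv ℝ (kuhnInterp r h c') x e * φ x := by
      refine integral_congr_ae ?_
      filter_upwards [ae_lineDeriv_kuhnInterp hr h hM e] with x hx
      rw [hx]
    rw [e3, hparts, ← integral_neg]
    refine integral_congr_ae (Eventually.of_forall fun x => ?_)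
    simp only
    rw [(hφ.differentiable (by simp)).differentiableAt.lineDeriv_eq_fderiv, map_neg]
    ring

end KuhnGradient

/-! ### Translations and difference quotients in `Lᵖ` -/

section Translation

variable {E F : Type*} [NormedAddCommGroup E] [NormedSpace ℝ E] [FiniteDimensional ℝ E]
  [MeasureSpace E] [BorelSpace E] [(volume : Measure E).IsAddHaarMeasure] [NormedAddCommGroup F]

lemma lintegral_enorm_rpow_lt_top {α : Type*} [MeasurableSpace α] {μ : Measure α} {p : ℝ}
    (hp : 1 ≤ p) {f : α → F} (hf : MemLp f (ENNReal.ofReal p) μ) :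
    ∫⁻ x, ‖f x‖ₑ ^ p ∂μ < ⊤ := by
  have hp0 : 0 < p := by linarith
  have := lintegral_rpow_enorm_lt_top_of_eLpNorm_lt_top (by simpa using hp0) ENNReal.ofReal_ne_top
    hf.2
  rwa [ENNReal.toReal_ofReal hp0.le] at this

lemma memLp_of_lintegral_enorm_rpow_lt_top {α : Type*} [MeasurableSpace α] {μ : Measure α} {p : ℝ}
    (hp : 1 ≤ p) {f : α → F} (hf : AEStronglyMeasurable f μ) (h : ∫⁻ x, ‖f x‖ₑ ^ p ∂μ < ⊤) :
    MemLp f (ENNReal.ofReal p) μ := by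
  have hp0 : 0 < p := by linarith
  refine ⟨hf, ?_⟩
  rw [eLpNorm_lt_top_iff_lintegral_rpow_enorm_lt_top (by simpa using hp0) ENNReal.ofReal_ne_top,
    ENNReal.toReal_ofReal hp0.le]
  exact h

/-- Translations act continuously on `Lᵖ`. -/
lemma tendsto_lintegral_translate_sub {p : ℝ} (hp : 1 ≤ p) {f : E → F}
    (hf : MemLp f (ENNReal.ofReal p) volume) :
    Tendsto (fun a : E => ∫⁻ x, ‖f (x + a) - f x‖ₑ ^ p) (𝓝 0) (𝓝 0) := by
  have hp0 : 0 < p := by linarith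
  have : Fact (1 ≤ ENNReal.ofReal p) := ⟨by simpa using ENNReal.ofReal_le_ofReal hp⟩
  have : Fact (ENNReal.ofReal p ≠ ⊤) := ⟨ENNReal.ofReal_ne_top⟩
  have hcont : Continuous fun a : E => edist (DomAddAct.mk a +ᵥ hf.toLp f) (hf.toLp f) := by
    refine Continuous.edist ?_ continuous_const
    exact (DomAddAct.continuous_mk (M := E)).vadd continuous_const
  have hpow := ((ENNReal.continuous_rpow_const (y := p)).comp hcont).tendsto 0
  simp only [Function.comp_apply] at hpow
  have h0 : DomAddAct.mk (0 : E) +ᵥ hf.toLp f = hf.toLp f := by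
    rw [DomAddAct.mk_zero, zero_vadd]
  rw [h0, edist_self, ENNReal.zero_rpow_of_pos hp0] at hpow
  refine hpow.congr fun a => ?_
  simp only [Function.comp_apply]
  rw [DomAddAct.mk_vadd_toLp, Lp.edist_toLp_toLp,
    eLpNorm_eq_lintegral_rpow_enorm_toReal (by simpa using hp0) ENNReal.ofReal_ne_top,
    ENNReal.toReal_ofReal hp0.le, ← ENNReal.rpow_mul, one_div, inv_mul_cancel₀ hp0.ne',
    ENNReal.rpow_one]
  refine lintegral_congr fun x => ?_
  simp [add_comm]

/-- Jensen's inequality for `|·|ᵖ`. -/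
lemma enorm_integral_rpow_le [NormedSpace ℝ F] {α : Type*} [MeasurableSpace α] {μ : Measure α}
    [IsProbabilityMeasure μ] {p : ℝ} (hp : 1 ≤ p) {f : α → F} (hf : AEStronglyMeasurable f μ) :
    ‖∫ t, f t ∂μ‖ₑ ^ p ≤ ∫⁻ t, ‖f t‖ₑ ^ p ∂μ := by
  have hp0 : 0 < p := by linarith
  have h1 := eLpNorm'_le_eLpNorm'_of_exponent_le one_pos hp μ hf
  rw [eLpNorm'_eq_lintegral_enorm, eLpNorm'_eq_lintegral_enorm] at h1
  simp only [ENNReal.rpow_one, div_one] at h1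
  calc ‖∫ t, f t ∂μ‖ₑ ^ p ≤ ((∫⁻ t, ‖f t‖ₑ ^ p ∂μ) ^ (1 / p)) ^ p := by
        gcongr
        exact (enorm_integral_le_lintegral_enorm f).trans h1
    _ = _ := by
        rw [← ENNReal.rpow_mul, one_div, inv_mul_cancel₀ hp0.ne', ENNReal.rpow_one]

/-- Jensen's inequality for almost every `x`, followed by Tonelli. -/
lemma lintegral_enorm_integral_rpow_le [NormedSpace ℝ F] {α β : Type*} [MeasurableSpace α]
    [MeasurableSpace β] {μ : Measure α} [IsProbabilityMeasure μ] {ν : Measure β} [SFinite ν] {p : ℝ}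
    (hp : 1 ≤ p) {f : α → β → F} (hf : AEStronglyMeasurable (Function.uncurry f) (μ.prod ν)) :
    ∫⁻ x, ‖∫ t, f t x ∂μ‖ₑ ^ p ∂ν ≤ ∫⁻ t, ∫⁻ x, ‖f t x‖ₑ ^ p ∂ν ∂μ := by
  have hswap : AEStronglyMeasurable (fun z : β × α => f z.2 z.1) (ν.prod μ) := hf.prod_swap
  calc ∫⁻ x, ‖∫ t, f t x ∂μ‖ₑ ^ p ∂ν ≤ ∫⁻ x, ∫⁻ t, ‖f t x‖ₑ ^ p ∂μ ∂ν := by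
        refine lintegral_mono_ae ?_
        filter_upwards [hswap.prodMk_left] with x hx
        exact enorm_integral_rpow_le hp hx
    _ = _ := by
        refine lintegral_lintegral_swap ?_
        exact hswap.enorm.pow_const p

/-- The shear `(t, x) ↦ (t, x + t e)`. -/
lemma measurePreserving_shear (μ : Measure ℝ) [SFinite μ] (e : E) :
    MeasurePreserving (fun z : ℝ × E => (z.1, z.2 + z.1 • e)) (μ.prod volume) (μ.prod volume) := by
  refine MeasurePreserving.skew_product (g := fun t x => x + t • e) (MeasurePreserving.id μ)
    (Continuous.measurable ?_) (Eventually.of_forall fun t => ?_)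
  · exact (continuous_snd.add (continuous_fst.smul continuous_const))
  · exact map_add_right_eq_self volume (t • e)

lemma aestronglyMeasurable_translate (μ : Measure ℝ) [SFinite μ] (e : E) {f : E → F}
    (hf : AEStronglyMeasurable f volume) :
    AEStronglyMeasurable (fun z : ℝ × E => f (z.2 + z.1 • e)) (μ.prod volume) :=
  (hf.comp_snd (μ := μ)).comp_measurePreserving (measurePreserving_shear μ e)

/-- Justifies the Fubini exchanges below. For `t ∈ (0, 1]` the support of `ψ (x - t e)` stays in a
fixed ball, so `f` can be cut off to an integrable function. -/
lemma integrable_mul_translate (e : E) {f : E → ℝ} (hf : LocallyIntegrable f) {ψ : E → ℝ}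
    (hψ : Continuous ψ) (hψc : HasCompactSupport ψ) :
    Integrable (fun z : ℝ × E => ψ (z.2 - z.1 • e) * f z.2)
      ((volume.restrict (Set.Ioc (0 : ℝ) 1)).prod volume) := by
  obtain ⟨R, hR⟩ := hψc.isCompact.isBounded.subset_closedBall (0 : E)
  obtain ⟨C, hC⟩ := hψ.bounded_above_of_compact_support hψc
  set K := Metric.closedBall (0 : E) (R + ‖e‖)
  have hK : Integrable (K.indicator f) :=
    (integrable_indicator_iff Metric.isClosed_closedBall.measurableSet).2
      (hf.integrableOn_isCompact (isCompact_closedBall _ _))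
  have hbound := (hK.comp_snd (volume.restrict (Set.Ioc (0 : ℝ) 1))).bdd_mul (c := C)
    (f := fun z : ℝ × E => ψ (z.2 - z.1 • e))
    (Continuous.aestronglyMeasurable
      (hψ.comp (continuous_snd.sub (continuous_fst.smul continuous_const))))
    (Eventually.of_forall fun z => hC _)
  refine hbound.congr ?_
  have hae : ∀ᵐ z : ℝ × E ∂((volume.restrict (Set.Ioc (0 : ℝ) 1)).prod volume),
      z.1 ∈ Set.Ioc (0 : ℝ) 1 :=
    Measure.quasiMeasurePreserving_fst.ae (ae_restrict_mem measurableSet_Ioc)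
  filter_upwards [hae] with z hz
  by_cases hzK : z.2 ∈ K
  · rw [Set.indicator_of_mem hzK]
  · have : ψ (z.2 - z.1 • e) = 0 := by
      refine image_eq_zero_of_notMem_tsupport fun hmem => hzK ?_
      have h1 := mem_closedBall_zero_iff.1 (hR hmem)
      refine mem_closedBall_zero_iff.2 ?_
      have h2 : ‖z.1 • e‖ ≤ ‖e‖ := by
        rw [norm_smul, Real.norm_of_nonneg hz.1.le]
        exact mul_le_of_le_one_left (norm_nonneg _) hz.2
      calc ‖z.2‖ = ‖(z.2 - z.1 • e) + z.1 • e‖ := by rw [sub_add_cancel]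
        _ ≤ _ := (norm_add_le _ _).trans (add_le_add h1 h2)
    rw [this, zero_mul, zero_mul]

lemma memLp_integral_translate {p : ℝ} (hp : 1 ≤ p) (e : E) {g : E → ℝ}
    (hg : MemLp g (ENNReal.ofReal p) volume) :
    MemLp (fun x => ∫ t in Set.Ioc (0 : ℝ) 1, g (x + t • e)) (ENNReal.ofReal p) volume := by
  have : IsProbabilityMeasure (volume.restrict (Set.Ioc (0 : ℝ) 1)) := ⟨by simp⟩
  have hm := aestronglyMeasurable_translate (volume.restrict (Set.Ioc (0 : ℝ) 1)) e hg.1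
  refine memLp_of_lintegral_enorm_rpow_lt_top hp hm.prod_swap.integral_prod_right' ?_
  refine (lintegral_enorm_integral_rpow_le hp (f := fun t x => g (x + t • e)) hm).trans_lt ?_
  simp_rw [lintegral_add_right_eq_self (fun x => ‖g x‖ₑ ^ p)]
  simpa using lintegral_enorm_rpow_lt_top hp hg

/-- The fundamental theorem of calculus along segments, for weakly differentiable functions. -/
lemma ae_sub_eq_integral_translate {p q : ℝ} (hp : 1 ≤ p) (hq : 1 ≤ q) (e : E) {u g : E → ℝ}
    (hu : MemLp u (ENNReal.ofReal q) volume) (hg : MemLp g (ENNReal.ofReal p) volume)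
    (hweak : ∀ φ : E → ℝ, ContDiff ℝ ∞ φ → HasCompactSupport φ →
      ∫ x, u x * fderiv ℝ φ x e = - ∫ x, g x * φ x) :
    ∀ᵐ x, u (x + e) - u x = ∫ t in Set.Ioc (0 : ℝ) 1, g (x + t • e) := by
  have hp1 : 1 ≤ ENNReal.ofReal p := by simpa using ENNReal.ofReal_le_ofReal hp
  have hq1 : 1 ≤ ENNReal.ofReal q := by simpa using ENNReal.ofReal_le_ofReal hq
  have hue : MemLp (fun x => u (x + e)) (ENNReal.ofReal q) volume :=
    hu.comp_measurePreserving (measurePreserving_add_right volume e)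
  have hgl := hg.locallyIntegrable hp1
  have hul := hu.locallyIntegrable hq1
  -- Both sides are tested against `φ`, which needs only local integrability, so `p` and `q` need
  -- not be related. The difference is moved onto `φ` and written as an integral of directional
  -- derivatives of translates of `φ`; the weak derivative identity holds for each translate.
  refine ae_eq_of_integral_contDiff_smul_eq ((hue.sub hu).locallyIntegrable hq1)
    ((memLp_integral_translate hp e hg).locallyIntegrable hp1) fun φ hφ hφc => ?_
  simp only [smul_eq_mul]
  have hdφ : Continuous fun x => fderiv ℝ φ x e :=
    (hφ.continuous_fderiv (by simp)).clm_apply continuous_const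
  have hdφc : HasCompactSupport fun x => fderiv ℝ φ x e :=
    (hφc.fderiv ℝ).comp_left (g := fun L : E →L[ℝ] ℝ => L e) rfl
  have hint1 := integrable_mul_translate e hgl hφ.continuous hφc
  have hint2 := integrable_mul_translate e hul hdφ hdφc
  have hint1' := (measurePreserving_shear (volume.restrict (Set.Ioc (0 : ℝ) 1)) e)
    |>.integrable_comp_of_integrable hint1
  have htrans : ∀ t : ℝ, ContDiff ℝ ∞ (fun x => φ (x - t • e)) ∧
      HasCompactSupport (fun x => φ (x - t • e)) := fun t => by
    refine ⟨hφ.comp (contDiff_id.sub contDiff_const), ?_⟩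
    simpa [sub_eq_add_neg, Function.comp_def] using
      hφc.comp_homeomorph (Homeomorph.addRight (-(t • e)))
  have hderiv : ∀ (t : ℝ) (x : E), fderiv ℝ (fun x => φ (x - t • e)) x e = fderiv ℝ φ (x - t • e) e :=
    fun t x => by rw [fderiv_comp_sub]
  have hcalc : ∀ x, ∫ t in Set.Ioc (0 : ℝ) 1, fderiv ℝ φ (x - t • e) e = φ x - φ (x - e) := by
    intro x
    have hd : ∀ t ∈ Set.uIcc (0 : ℝ) 1,
        HasDerivAt (fun t : ℝ => -φ (x - t • e)) (fderiv ℝ φ (x - t • e) e) t := by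
      intro t _
      have h1 : HasDerivAt (fun t : ℝ => x - t • e) (-e) t := by
        simpa using ((hasDerivAt_id t).smul_const e).const_sub x
      have h2 := ((hφ.differentiable (by simp)).differentiableAt (x := x - t • e)).hasFDerivAt
        |>.comp_hasDerivAt t h1
      have h3 := h2.neg
      rw [map_neg, neg_neg] at h3
      exact h3
    rw [← intervalIntegral.integral_of_le zero_le_one,
      intervalIntegral.integral_eq_sub_of_hasDerivAt hd]
    · simp
      ring
    · refine Continuous.intervalIntegrable ?_ _ _
      exact hdφ.comp (continuous_const.sub (continuous_id.smul continuous_const))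
  calc ∫ x, φ x * (u (x + e) - u x)
      = ∫ x, (φ (x - e) - φ x) * u x := by
        have i1 : Integrable fun x => φ x * u (x + e) :=
          (hue.locallyIntegrable hq1).integrable_smul_left_of_hasCompactSupport hφ.continuous hφc
        have i2 : Integrable fun x => φ x * u x :=
          hul.integrable_smul_left_of_hasCompactSupport hφ.continuous hφc
        have i3 : Integrable fun x => φ (x - e) * u x := by
          have := (htrans 1)
          simp only [one_smul] at this
          exact hul.integrable_smul_left_of_hasCompactSupport this.1.continuous this.2
        simp_rw [mul_sub, sub_mul]
        rw [integral_sub i1 i2, integral_sub i3 i2,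
          ← integral_add_right_eq_self (fun x => φ (x - e) * u x) e]
        simp
    _ = -∫ x, ∫ t in Set.Ioc (0 : ℝ) 1, fderiv ℝ φ (x - t • e) e * u x := by
        simp_rw [integral_mul_const, hcalc]
        rw [← integral_neg]
        refine integral_congr_ae (Eventually.of_forall fun x => ?_)
        simp only
        ring
    _ = -∫ t in Set.Ioc (0 : ℝ) 1, ∫ x, fderiv ℝ φ (x - t • e) e * u x := by
        rw [integral_integral_swap]
        exact hint2.swap
    _ = ∫ t in Set.Ioc (0 : ℝ) 1, ∫ x, φ (x - t • e) * g x := by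
        rw [← integral_neg]
        refine integral_congr_ae (Eventually.of_forall fun t => ?_)
        have := hweak _ (htrans t).1 (htrans t).2
        simp_rw [hderiv] at this
        simp_rw [mul_comm _ (u _), this, mul_comm (g _), neg_neg]
    _ = ∫ t in Set.Ioc (0 : ℝ) 1, ∫ x, φ x * g (x + t • e) := by
        refine integral_congr_ae (Eventually.of_forall fun t => ?_)
        simp only
        rw [← integral_add_right_eq_self (fun x => φ (x - t • e) * g x) (t • e)]
        simp
    _ = ∫ x, ∫ t in Set.Ioc (0 : ℝ) 1, φ x * g (x + t • e) := by
        refine integral_integral_swap ?_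
        refine hint1'.congr (Eventually.of_forall fun z => ?_)
        simp [Function.uncurry]
    _ = _ := by simp_rw [integral_const_mul]

/-- Difference quotients approximate the weak derivative as well as translates do. -/
lemma lintegral_diffQuotient_sub_le {p q : ℝ} (hp : 1 ≤ p) (hq : 1 ≤ q) (e : E) {u g : E → ℝ}
    (hu : MemLp u (ENNReal.ofReal q) volume) (hg : MemLp g (ENNReal.ofReal p) volume)
    (hweak : ∀ φ : E → ℝ, ContDiff ℝ ∞ φ → HasCompactSupport φ →
      ∫ x, u x * fderiv ℝ φ x e = - ∫ x, g x * φ x) {r : ℝ} (hr : 0 < r) :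
    ∫⁻ x, ‖r⁻¹ * (u (x + r • e) - u x) - g x‖ₑ ^ p ≤
      ∫⁻ t in Set.Ioc (0 : ℝ) 1, ∫⁻ x, ‖g (x + t • r • e) - g x‖ₑ ^ p := by
  have : IsProbabilityMeasure (volume.restrict (Set.Ioc (0 : ℝ) 1)) := ⟨by simp⟩
  -- Along `r • e` the weak derivative is `r * g`; the factor cancels the one in the quotient.
  have hid := ae_sub_eq_integral_translate hp hq (r • e) hu (hg.const_mul r) fun φ hφ hφc => by
    simp_rw [map_smul, smul_eq_mul, mul_left_comm _ r, mul_assoc]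
    rw [integral_const_mul, integral_const_mul, hweak φ hφ hφc, mul_neg]
  have hm := aestronglyMeasurable_translate (volume.restrict (Set.Ioc (0 : ℝ) 1)) (r • e) hg.1
  have hint : ∀ᵐ x, Integrable (fun t : ℝ => g (x + t • r • e))
      (volume.restrict (Set.Ioc (0 : ℝ) 1)) := by
    have hswap : AEStronglyMeasurable (fun z : E × ℝ => g (z.1 + z.2 • r • e))
      (volume.prod (volume.restrict (Set.Ioc (0 : ℝ) 1))) := hm.prod_swap
    have hfin : ∫⁻ x, ∫⁻ t in Set.Ioc (0 : ℝ) 1, ‖g (x + t • r • e)‖ₑ ^ p < ⊤ := by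
      rw [lintegral_lintegral_swap (hswap.enorm.pow_const p)]
      simp_rw [lintegral_add_right_eq_self (fun x => ‖g x‖ₑ ^ p)]
      simpa using lintegral_enorm_rpow_lt_top hp hg
    filter_upwards [ae_lt_top' (hswap.enorm.pow_const p).lintegral_prod_right' hfin.ne,
      hswap.prodMk_left] with x hx hxm
    exact (memLp_of_lintegral_enorm_rpow_lt_top hp hxm hx).integrable
      (by simpa using ENNReal.ofReal_le_ofReal hp)
  calc ∫⁻ x, ‖r⁻¹ * (u (x + r • e) - u x) - g x‖ₑ ^ p
      = ∫⁻ x, ‖∫ t in Set.Ioc (0 : ℝ) 1, (g (x + t • r • e) - g x)‖ₑ ^ p := by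
        refine lintegral_congr_ae ?_
        filter_upwards [hid, hint] with x hx hxi
        rw [hx, integral_const_mul, integral_sub hxi (integrable_const _),
          inv_mul_cancel_left₀ hr.ne']
        simp
    _ ≤ _ := lintegral_enorm_integral_rpow_le hp (f := fun t x => g (x + t • r • e) - g x)
        (hm.sub (hg.1.comp_snd (μ := volume.restrict (Set.Ioc (0 : ℝ) 1))))

lemma exists_forall_norm_lt_lintegral_translate_sub_le {p : ℝ} (hp : 1 ≤ p) {f : E → F}
    (hf : MemLp f (ENNReal.ofReal p) volume) {δ : ℝ≥0∞} (hδ : 0 < δ) :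
    ∃ ρ > 0, ∀ a : E, ‖a‖ < ρ → ∫⁻ x, ‖f (x + a) - f x‖ₑ ^ p ≤ δ := by
  have := (tendsto_lintegral_translate_sub hp hf).eventually (gt_mem_nhds hδ)
  obtain ⟨ρ, hρ, h⟩ := Metric.eventually_nhds_iff.1 this
  exact ⟨ρ, hρ, fun a ha => (h (by simpa using ha)).le⟩

end Translation

/-! ### Averaging over the translations of the grid -/

section Averaging

variable {n : ℕ}

/-- The standard lattice `ℤⁿ` in `ℝⁿ`. -/
abbrev stdLattice (n : ℕ) : AddSubgroup (EuclideanSpace ℝ (Fin n)) :=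
  (Submodule.span ℤ (Set.range (EuclideanSpace.basisFun (Fin n) ℝ).toBasis)).toAddSubgroup

instance countable_stdLattice : Countable (stdLattice n) :=
  inferInstanceAs (Countable (Submodule.span ℤ
    (Set.range (EuclideanSpace.basisFun (Fin n) ℝ).toBasis)))

/-- The unit cell of the standard lattice. -/
abbrev unitCell (n : ℕ) : Set (EuclideanSpace ℝ (Fin n)) :=
  ZSpan.fundamentalDomain (EuclideanSpace.basisFun (Fin n) ℝ).toBasis

lemma toLp_intCast_mem_stdLattice (z : Fin n → ℤ) :
    (WithLp.toLp 2 (fun i => (z i : ℝ)) : EuclideanSpace ℝ (Fin n)) ∈ stdLattice n := by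
  rw [Submodule.mem_toAddSubgroup, Module.Basis.mem_span_iff_repr_mem]
  intro i
  exact ⟨z i, by simp⟩

/-- `f x (r w)`, cut off to the points `r w` within distance `r C` of `x`. -/
noncomputable def gridTerm {n : ℕ} (r C : ℝ)
    (f : EuclideanSpace ℝ (Fin n) → EuclideanSpace ℝ (Fin n) → ℝ≥0∞)
    (x w : EuclideanSpace ℝ (Fin n)) : ℝ≥0∞ :=
  (Metric.closedBall (r⁻¹ • x) C).indicator (fun w => f x (r • w)) w

/-- The sum of `f x P` over the points `P` of the grid `r (ℤⁿ + k)` within distance `r C`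
of `x`. -/
noncomputable def gridSum {n : ℕ} (r C : ℝ)
    (f : EuclideanSpace ℝ (Fin n) → EuclideanSpace ℝ (Fin n) → ℝ≥0∞)
    (k x : EuclideanSpace ℝ (Fin n)) : ℝ≥0∞ :=
  ∑' l : stdLattice n, gridTerm r C f x (l + k)

lemma measurable_gridTerm (r C : ℝ)
    {f : EuclideanSpace ℝ (Fin n) → EuclideanSpace ℝ (Fin n) → ℝ≥0∞}
    (hf : Measurable (Function.uncurry f)) : Measurable (Function.uncurry (gridTerm r C f)) := by
  have h1 : Measurable fun z : EuclideanSpace ℝ (Fin n) × EuclideanSpace ℝ (Fin n) =>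
      f z.1 (r • z.2) :=
    hf.comp (measurable_fst.prodMk (measurable_snd.const_smul r))
  have h2 : MeasurableSet {z : EuclideanSpace ℝ (Fin n) × EuclideanSpace ℝ (Fin n) |
      dist z.2 (r⁻¹ • z.1) ≤ C} := by
    refine IsClosed.measurableSet (isClosed_le ?_ continuous_const)
    fun_prop
  exact h1.indicator h2

lemma measurable_gridSum (r C : ℝ)
    {f : EuclideanSpace ℝ (Fin n) → EuclideanSpace ℝ (Fin n) → ℝ≥0∞}
    (hf : Measurable (Function.uncurry f)) :
    Measurable (Function.uncurry (gridSum r C f)) := by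
  have h : ∀ l : stdLattice n,
      Measurable fun z : EuclideanSpace ℝ (Fin n) × EuclideanSpace ℝ (Fin n) =>
        gridTerm r C f z.2 (l + z.1) := fun l =>
    (measurable_gridTerm r C hf).comp
      (f := fun z : EuclideanSpace ℝ (Fin n) × EuclideanSpace ℝ (Fin n) =>
        (z.2, (l : EuclideanSpace ℝ (Fin n)) + z.1))
      (measurable_snd.prodMk (measurable_fst.const_add _))
  exact Measurable.tsum h

/-- Averaging over the translations of the grid unfolds the sum over the grid points. -/
lemma lintegral_gridSum {r : ℝ} (hr : 0 < r) (C : ℝ)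
    {f : EuclideanSpace ℝ (Fin n) → EuclideanSpace ℝ (Fin n) → ℝ≥0∞}
    (hf : Measurable (Function.uncurry f)) :
    ∫⁻ k in unitCell n, ∫⁻ x, gridSum r C f k x =
      ∫⁻ ζ in Metric.closedBall (0 : EuclideanSpace ℝ (Fin n)) C, ∫⁻ x, f x (x + r • ζ) := by
  have hFD : IsAddFundamentalDomain (stdLattice n) (unitCell n)
      (volume : Measure (EuclideanSpace ℝ (Fin n))) := ZSpan.isAddFundamentalDomain' _ _
  have hterm : ∀ (x : EuclideanSpace ℝ (Fin n)) (l : stdLattice n),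
      Measurable fun k => gridTerm r C f x (l + k) := fun x l =>
    (measurable_gridTerm r C hf).comp
      (f := fun k => (x, (l : EuclideanSpace ℝ (Fin n)) + k))
      (measurable_const.prodMk (measurable_id.const_add _))
  have hdiag : Measurable (Function.uncurry fun x ζ : EuclideanSpace ℝ (Fin n) =>
      f x (x + r • ζ)) :=
    hf.comp (f := fun z : EuclideanSpace ℝ (Fin n) × EuclideanSpace ℝ (Fin n) =>
      (z.1, z.1 + r • z.2))
      (measurable_fst.prodMk (measurable_fst.add (measurable_snd.const_smul r)))
  calc ∫⁻ k in unitCell n, ∫⁻ x, gridSum r C f k x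
      = ∫⁻ x, ∫⁻ k in unitCell n, gridSum r C f k x :=
        lintegral_lintegral_swap (measurable_gridSum r C hf).aemeasurable
    _ = ∫⁻ x, ∫⁻ w, gridTerm r C f x w := by
        refine lintegral_congr fun x => ?_
        -- The lattice translates of the unit cell tile the space, so the integral over the cell of
        -- the sum over the lattice is one integral over the whole space.
        rw [hFD.lintegral_eq_tsum'' (gridTerm r C f x)]
        exact lintegral_tsum fun l => (hterm x l).aemeasurable
    _ = ∫⁻ x, ∫⁻ ζ in Metric.closedBall (0 : EuclideanSpace ℝ (Fin n)) C, f x (x + r • ζ) := by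
        refine lintegral_congr fun x => ?_
        -- The substitution `w = r⁻¹ x + ζ` turns the cut-off into a ball for `ζ` that no longer
        -- depends on `x`.
        rw [← lintegral_add_left_eq_self _ (r⁻¹ • x),
          ← lintegral_indicator Metric.isClosed_closedBall.measurableSet]
        refine lintegral_congr fun ζ => ?_
        simp only [gridTerm, Set.indicator, Metric.mem_closedBall, dist_eq_norm,
          add_sub_cancel_left, sub_zero, smul_add, smul_inv_smul₀ hr.ne']
    _ = _ := lintegral_lintegral_swap hdiag.aemeasurable

/-- Off any null set, a function takes a value not exceeding its average over the unit cell. -/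
lemma exists_shift_lintegral_gridSum_le {r : ℝ} (hr : 0 < r) (C : ℝ)
    {f : EuclideanSpace ℝ (Fin n) → EuclideanSpace ℝ (Fin n) → ℝ≥0∞}
    (hf : Measurable (Function.uncurry f)) {δ : ℝ≥0∞}
    (hδ : ∀ ζ ∈ Metric.closedBall (0 : EuclideanSpace ℝ (Fin n)) C, ∫⁻ x, f x (x + r • ζ) ≤ δ)
    {N : Set (EuclideanSpace ℝ (Fin n))} (hN : volume N = 0) :
    ∃ k ∉ N, ∫⁻ x, gridSum r C f k x ≤ (volume (unitCell n))⁻¹ *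
      (δ * volume (Metric.closedBall (0 : EuclideanSpace ℝ (Fin n)) C)) := by
  have hne : (volume : Measure (EuclideanSpace ℝ (Fin n))).restrict (unitCell n) ≠ 0 := by
    rw [Ne, Measure.restrict_eq_zero]
    exact ZSpan.measure_fundamentalDomain_ne_zero _
  have hN' : (volume : Measure (EuclideanSpace ℝ (Fin n))).restrict (unitCell n) N = 0 :=
    le_antisymm ((Measure.restrict_apply_le _ _).trans hN.le) bot_le
  have : IsFiniteMeasure ((volume : Measure (EuclideanSpace ℝ (Fin n))).restrict (unitCell n)) :=
    isFiniteMeasure_restrict.2 (ZSpan.fundamentalDomain_isBounded _).measure_lt_top.ne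
  have hmeas : Measurable fun k => ∫⁻ x, gridSum r C f k x :=
    (measurable_gridSum r C hf).lintegral_prod_right
  obtain ⟨k, hk, hle⟩ := exists_notMem_null_le_laverage hne hmeas.aemeasurable hN'
  refine ⟨k, hk, hle.trans ?_⟩
  rw [laverage_eq', lintegral_smul_measure, Measure.restrict_apply_univ, smul_eq_mul]
  gcongr
  calc ∫⁻ k in unitCell n, ∫⁻ x, gridSum r C f k x
      = ∫⁻ ζ in Metric.closedBall (0 : EuclideanSpace ℝ (Fin n)) C, ∫⁻ x, f x (x + r • ζ) :=
        lintegral_gridSum hr C hf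
    _ ≤ ∫⁻ _ζ in Metric.closedBall (0 : EuclideanSpace ℝ (Fin n)) C, δ :=
        setLIntegral_mono' Metric.isClosed_closedBall.measurableSet hδ
    _ = _ := by rw [setLIntegral_const]

lemma norm_le_sum_abs (v : EuclideanSpace ℝ (Fin n)) : ‖v‖ ≤ ∑ i, |v i| := by
  conv_lhs => rw [← sum_smul_single v]
  refine (norm_sum_le _ _).trans (le_of_eq ?_)
  simp [norm_smul]

/-- The source of the cut-off radius `n`. The value `θ = 1` is included because `kuhnJump` can
attain it. -/
lemma norm_shiftFloor_sub_le (y : EuclideanSpace ℝ (Fin n)) {θ : ℝ} (hθ : θ ∈ Set.Icc (0 : ℝ) 1) :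
    ‖WithLp.toLp 2 (fun i => (shiftFloor y θ i : ℝ)) - y‖ ≤ n := by
  refine (norm_le_sum_abs _).trans ?_
  refine (Finset.sum_le_sum (g := fun _ => (1 : ℝ)) fun i _ => ?_).trans (by simp)
  simp only [PiLp.sub_apply, shiftFloor]
  have h1 := Int.floor_le (y i + θ)
  have h2 := Int.lt_floor_add_one (y i + θ)
  exact abs_le.2 ⟨by linarith [hθ.1], by linarith [hθ.2]⟩

/-- The grid points met by `⌊y + θ⌋` are accounted for in `gridSum`. -/
lemma le_gridSum {r : ℝ} (hr : 0 < r)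
    (f : EuclideanSpace ℝ (Fin n) → EuclideanSpace ℝ (Fin n) → ℝ≥0∞)
    (k x : EuclideanSpace ℝ (Fin n)) {θ : ℝ} (hθ : θ ∈ Set.Icc (0 : ℝ) 1) :
    f x (gridPoint r (r • k) (shiftFloor (r⁻¹ • (x - r • k)) θ)) ≤ gridSum r n f k x := by
  set z := shiftFloor (r⁻¹ • (x - r • k)) θ with hz
  have hnear := norm_shiftFloor_sub_le (r⁻¹ • (x - r • k)) hθ
  rw [← hz] at hnear
  refine le_trans (le_of_eq ?_) (ENNReal.le_tsum ⟨_, toLp_intCast_mem_stdLattice z⟩)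
  rw [gridTerm, Set.indicator_of_mem]
  · rw [smul_add]
    rfl
  · rw [Metric.mem_closedBall, dist_eq_norm]
    refine le_trans (le_of_eq ?_) hnear
    rw [smul_sub, inv_smul_smul₀ hr.ne']
    congr 1
    abel

lemma gridSum_add (r C : ℝ) (f g : EuclideanSpace ℝ (Fin n) → EuclideanSpace ℝ (Fin n) → ℝ≥0∞)
    (k x : EuclideanSpace ℝ (Fin n)) :
    gridSum r C (fun x w => f x w + g x w) k x = gridSum r C f k x + gridSum r C g k x := by
  rw [gridSum, gridSum, gridSum, ← ENNReal.tsum_add]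
  refine tsum_congr fun l => ?_
  simp only [gridTerm, Set.indicator]
  split_ifs <;> simp

lemma norm_clm_le_sum (L : EuclideanSpace ℝ (Fin n) →L[ℝ] ℝ) :
    ‖L‖ ≤ ∑ i, ‖L (EuclideanSpace.single i 1)‖ := by
  refine L.opNorm_le_bound (Finset.sum_nonneg fun _ _ => norm_nonneg _) fun v => ?_
  conv_lhs => rw [← sum_smul_single v, map_sum]
  rw [Finset.sum_mul]
  refine (norm_sum_le _ _).trans (Finset.sum_le_sum fun i _ => ?_)
  rw [map_smul, norm_smul, mul_comm]
  gcongr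
  exact PiLp.norm_apply_le v i

lemma enorm_clm_rpow_le_sum {p : ℝ} (hp : 1 ≤ p) (L : EuclideanSpace ℝ (Fin n) →L[ℝ] ℝ) :
    ‖L‖ₑ ^ p ≤ (n : ℝ≥0∞) ^ (p - 1) * ∑ i, ‖L (EuclideanSpace.single i 1)‖ₑ ^ p := by
  have h1 : ‖L‖ₑ ≤ ∑ i, ‖L (EuclideanSpace.single i 1)‖ₑ := by
    have := ENNReal.ofReal_le_ofReal (norm_clm_le_sum L)
    rw [ENNReal.ofReal_sum_of_nonneg fun _ _ => norm_nonneg _] at this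
    simpa only [ofReal_norm] using this
  refine (ENNReal.rpow_le_rpow h1 (by linarith)).trans ?_
  simpa using ENNReal.rpow_sum_le_const_mul_sum_rpow Finset.univ
    (fun i => ‖L (EuclideanSpace.single i 1)‖ₑ) hp

lemma gridPoint_sub_single (r : ℝ) (h : EuclideanSpace ℝ (Fin n)) (z : Fin n → ℤ) (i : Fin n) :
    gridPoint r h (z - Pi.single i 1) = gridPoint r h z - r • EuclideanSpace.single i (1 : ℝ) := by
  ext j
  by_cases hj : j = i
  · subst hj
    simp
    ring
  · simp [hj]

/-- The error is the mean over `θ` of `u x - u P` with `P` a nearby grid point. Jensen's inequality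
bounds its power by the mean of the powers, and the sum over all nearby grid points dominates each
of them. -/
lemma enorm_sub_kuhnInterp_rpow_le {q r : ℝ} (hq : 1 ≤ q) (hr : 0 < r)
    (u : EuclideanSpace ℝ (Fin n) → ℝ) (k x : EuclideanSpace ℝ (Fin n)) :
    ‖u x - kuhnInterp r (r • k) (fun z => u (gridPoint r (r • k) z)) x‖ₑ ^ q ≤
      gridSum r n (fun x w => ‖u x - u w‖ₑ ^ q) k x := by
  have : IsProbabilityMeasure (volume.restrict (Set.Ico (0 : ℝ) 1)) := ⟨by simp⟩
  have hint := integrableOn_comp_shiftFloor (fun z => u (gridPoint r (r • k) z))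
    (r⁻¹ • (x - r • k))
  have heq : u x - kuhnInterp r (r • k) (fun z => u (gridPoint r (r • k) z)) x =
      ∫ θ in Set.Ico (0 : ℝ) 1,
        (u x - u (gridPoint r (r • k) (shiftFloor (r⁻¹ • (x - r • k)) θ))) := by
    rw [integral_sub (integrable_const _) hint]
    simp [kuhnInterp]
  rw [heq]
  refine (enorm_integral_rpow_le hq ((integrable_const _).sub hint).aestronglyMeasurable).trans ?_
  calc _ ≤ ∫⁻ _θ in Set.Ico (0 : ℝ) 1, gridSum r n (fun x w => ‖u x - u w‖ₑ ^ q) k x :=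
        setLIntegral_mono' measurableSet_Ico fun θ hθ =>
          le_gridSum hr (fun x w => ‖u x - u w‖ₑ ^ q) k x ⟨hθ.1, hθ.2.le⟩
    _ = _ := by simp

lemma enorm_sub_kuhnGrad_rpow_le {p r : ℝ} (hp : 1 ≤ p) (hr : 0 < r)
    (u : EuclideanSpace ℝ (Fin n) → ℝ)
    (G : EuclideanSpace ℝ (Fin n) → (EuclideanSpace ℝ (Fin n) →L[ℝ] ℝ))
    (k x : EuclideanSpace ℝ (Fin n)) :
    ‖G x - kuhnGrad r (r • k) (fun z => u (gridPoint r (r • k) z)) x‖ₑ ^ p ≤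
      gridSum r n (fun x w => (n : ℝ≥0∞) ^ (p - 1) * ∑ i, ‖G x (EuclideanSpace.single i 1) -
        r⁻¹ * (u w - u (w - r • EuclideanSpace.single i 1))‖ₑ ^ p) k x := by
  refine (enorm_clm_rpow_le_sum hp _).trans ?_
  have hsum : gridSum r n (fun x w => (n : ℝ≥0∞) ^ (p - 1) * ∑ i,
      ‖G x (EuclideanSpace.single i 1) -
        r⁻¹ * (u w - u (w - r • EuclideanSpace.single i 1))‖ₑ ^ p) k x =
      (n : ℝ≥0∞) ^ (p - 1) * ∑ i, gridSum r n (fun x w => ‖G x (EuclideanSpace.single i 1) -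
        r⁻¹ * (u w - u (w - r • EuclideanSpace.single i 1))‖ₑ ^ p) k x := by
    simp only [gridSum]
    rw [← Summable.tsum_finsetSum fun _ _ => ENNReal.summable, ← ENNReal.tsum_mul_left]
    refine tsum_congr fun l => ?_
    simp only [gridTerm, Set.indicator]
    split_ifs <;> simp
  rw [hsum]
  gcongr with i
  rw [sub_apply, kuhnGrad_single, gridPoint_sub_single]
  have hfr := Int.fract_nonneg ((r⁻¹ • (x - r • k)) i)
  have hfr' := Int.fract_lt_one ((r⁻¹ • (x - r • k)) i)
  exact le_gridSum hr (fun x w => ‖G x (EuclideanSpace.single i 1) -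
    r⁻¹ * (u w - u (w - r • EuclideanSpace.single i 1))‖ₑ ^ p) k x
    (θ := 1 - Int.fract ((r⁻¹ • (x - r • k)) i)) ⟨by linarith, by linarith⟩

lemma measurable_comp_add_const {f : EuclideanSpace ℝ (Fin n) → EuclideanSpace ℝ (Fin n) → ℝ≥0∞}
    (hf : Measurable (Function.uncurry f)) (b : EuclideanSpace ℝ (Fin n)) :
    Measurable fun x => f x (x + b) :=
  hf.comp (f := fun x => (x, x + b)) (measurable_id.prodMk (measurable_id.add_const b))

/-- The quotient belongs to the edge that starts at `x + a`, with `a = b - r • e`. Inserting `g (x +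
a)` leaves a translation error of `g` and the error of the quotient at its own base point; the
factor `2 ^ (p - 1)` comes from convexity. -/
lemma lintegral_sub_diffQuotient_le {p q : ℝ} (hp : 1 ≤ p) (hq : 1 ≤ q)
    {u g : EuclideanSpace ℝ (Fin n) → ℝ} {e : EuclideanSpace ℝ (Fin n)}
    (hgm : StronglyMeasurable g)
    (hu : MemLp u (ENNReal.ofReal q) volume) (hg : MemLp g (ENNReal.ofReal p) volume)
    (hweak : ∀ φ : EuclideanSpace ℝ (Fin n) → ℝ, ContDiff ℝ ∞ φ → HasCompactSupport φ →
      ∫ x, u x * fderiv ℝ φ x e = - ∫ x, g x * φ x)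
    {ρ : ℝ} {δ : ℝ≥0∞} (hδ : ∀ a, ‖a‖ < ρ → ∫⁻ x, ‖g (x + a) - g x‖ₑ ^ p ≤ δ)
    {r : ℝ} (hr : 0 < r) {b : EuclideanSpace ℝ (Fin n)} (hre : ‖r • e‖ < ρ)
    (hb : ‖b - r • e‖ < ρ) :
    ∫⁻ x, ‖g x - r⁻¹ * (u (x + b) - u (x + b - r • e))‖ₑ ^ p ≤
      (2 : ℝ≥0∞) ^ (p - 1) * (2 * δ) := by
  set a := b - r • e with ha
  have hquot : ∫⁻ x, ‖r⁻¹ * (u (x + r • e) - u x) - g x‖ₑ ^ p ≤ δ := by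
    refine (lintegral_diffQuotient_sub_le hp hq e hu hg hweak hr).trans ?_
    calc _ ≤ ∫⁻ _t in Set.Ioc (0 : ℝ) 1, δ := by
          refine setLIntegral_mono' measurableSet_Ioc fun t ht => hδ _ ?_
          rw [norm_smul, Real.norm_of_nonneg ht.1.le]
          exact (mul_le_of_le_one_left (norm_nonneg _) ht.2).trans_lt hre
      _ = δ := by simp
  have hmeas : Measurable fun x => ‖g (x + a) - g x‖ₑ ^ p :=
    Measurable.pow_const (Measurable.enorm ((hgm.measurable.comp
      (measurable_id.add_const a)).sub hgm.measurable)) p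
  calc ∫⁻ x, ‖g x - r⁻¹ * (u (x + b) - u (x + b - r • e))‖ₑ ^ p
      ≤ ∫⁻ x, (2 : ℝ≥0∞) ^ (p - 1) * (‖g (x + a) - g x‖ₑ ^ p +
          ‖r⁻¹ * (u (x + a + r • e) - u (x + a)) - g (x + a)‖ₑ ^ p) := by
        refine lintegral_mono fun x => ?_
        refine le_trans ?_ (ENNReal.rpow_add_le_mul_rpow_add_rpow _ _ hp)
        gcongr
        have h1 : x + a + r • e = x + b := by rw [ha]; abel
        have h2 : x + b - r • e = x + a := by rw [ha]; abel
        rw [h1, h2, ← enorm_neg]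
        refine le_trans (le_of_eq ?_) (enorm_add_le _ _)
        congr 1
        ring
    _ = (2 : ℝ≥0∞) ^ (p - 1) * ((∫⁻ x, ‖g (x + a) - g x‖ₑ ^ p) +
          ∫⁻ x, ‖r⁻¹ * (u (x + r • e) - u x) - g x‖ₑ ^ p) := by
        rw [lintegral_const_mul' _ _ (ENNReal.rpow_ne_top_of_nonneg (by linarith)
          ENNReal.ofNat_ne_top), lintegral_add_left hmeas,
          lintegral_add_right_eq_self (fun x => ‖r⁻¹ * (u (x + r • e) - u x) - g x‖ₑ ^ p) a]
    _ ≤ (2 : ℝ≥0∞) ^ (p - 1) * (2 * δ) := by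
        rw [two_mul]
        gcongr
        exact hδ a hb

/-- The error made when the partial derivatives at `x` are replaced by the difference quotients of
step `r` that end at `w`. -/
noncomputable def gradError {n : ℕ} (p r : ℝ) (u : EuclideanSpace ℝ (Fin n) → ℝ)
    (G : EuclideanSpace ℝ (Fin n) → (EuclideanSpace ℝ (Fin n) →L[ℝ] ℝ))
    (x w : EuclideanSpace ℝ (Fin n)) : ℝ≥0∞ :=
  (n : ℝ≥0∞) ^ (p - 1) * ∑ i, ‖G x (EuclideanSpace.single i 1) -
    r⁻¹ * (u w - u (w - r • EuclideanSpace.single i 1))‖ₑ ^ p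

lemma stronglyMeasurable_clm_apply
    {G : EuclideanSpace ℝ (Fin n) → (EuclideanSpace ℝ (Fin n) →L[ℝ] ℝ)}
    (hGm : StronglyMeasurable G) (e : EuclideanSpace ℝ (Fin n)) :
    StronglyMeasurable fun x => G x e :=
  (ContinuousLinearMap.apply ℝ ℝ e).continuous.comp_stronglyMeasurable hGm

lemma measurable_enorm_sub_diffQuotient (p r : ℝ) {u : EuclideanSpace ℝ (Fin n) → ℝ}
    {G : EuclideanSpace ℝ (Fin n) → (EuclideanSpace ℝ (Fin n) →L[ℝ] ℝ)}
    (hum : StronglyMeasurable u) (hGm : StronglyMeasurable G) (e : EuclideanSpace ℝ (Fin n)) :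
    Measurable fun z : EuclideanSpace ℝ (Fin n) × EuclideanSpace ℝ (Fin n) =>
      ‖G z.1 e - r⁻¹ * (u z.2 - u (z.2 - r • e))‖ₑ ^ p := by
  refine Measurable.pow_const (Measurable.enorm ?_) p
  refine ((stronglyMeasurable_clm_apply hGm e).measurable.comp measurable_fst).sub
    (measurable_const.mul ?_)
  exact (hum.measurable.comp measurable_snd).sub
    (hum.measurable.comp (measurable_snd.sub measurable_const))

lemma measurable_gradError (p r : ℝ) {u : EuclideanSpace ℝ (Fin n) → ℝ}
    {G : EuclideanSpace ℝ (Fin n) → (EuclideanSpace ℝ (Fin n) →L[ℝ] ℝ)}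
    (hum : StronglyMeasurable u) (hGm : StronglyMeasurable G) :
    Measurable (Function.uncurry (gradError p r u G)) :=
  measurable_const.mul (Finset.measurable_fun_sum _ fun _ _ =>
    measurable_enorm_sub_diffQuotient p r hum hGm _)

/-- The condition `‖b‖ + r < ρ` keeps both the edge and the base point of the quotient within `ρ`.
Translation errors of the components of `G` are dominated by those of `G`, as the basis vectors have
norm 1. -/
lemma lintegral_gradError_le {p q : ℝ} (hp : 1 ≤ p) (hq : 1 ≤ q)
    {u : EuclideanSpace ℝ (Fin n) → ℝ}
    {G : EuclideanSpace ℝ (Fin n) → (EuclideanSpace ℝ (Fin n) →L[ℝ] ℝ)}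
    (hum : StronglyMeasurable u) (hGm : StronglyMeasurable G)
    (hu : MemLp u (ENNReal.ofReal q) volume) (hG : MemLp G (ENNReal.ofReal p) volume)
    (hw : HasWeakDeriv u G) {ρ : ℝ} {δ : ℝ≥0∞}
    (hδ : ∀ a, ‖a‖ < ρ → ∫⁻ x, ‖G (x + a) - G x‖ₑ ^ p ≤ δ)
    {r : ℝ} (hr : 0 < r) {b : EuclideanSpace ℝ (Fin n)} (hb : ‖b‖ + r < ρ) :
    ∫⁻ x, gradError p r u G x (x + b) ≤
      (n : ℝ≥0∞) ^ (p - 1) * (n * ((2 : ℝ≥0∞) ^ (p - 1) * 2)) * δ := by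
  have hshift : Measurable fun x : EuclideanSpace ℝ (Fin n) => (x, x + b) :=
    measurable_id.prodMk (measurable_id.add_const _)
  have hne : ∀ i : Fin n, ‖r • EuclideanSpace.single i (1 : ℝ)‖ = r := fun i => by
    rw [norm_smul, Real.norm_of_nonneg hr.le]
    simp
  have hmi : ∀ i : Fin n, Measurable fun x => ‖G x (EuclideanSpace.single i 1) -
      r⁻¹ * (u (x + b) - u (x + b - r • EuclideanSpace.single i 1))‖ₑ ^ p := fun i =>
    (measurable_enorm_sub_diffQuotient p r hum hGm _).comp hshift
  have hi : ∀ i : Fin n, ∫⁻ x, ‖G x (EuclideanSpace.single i 1) -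
      r⁻¹ * (u (x + b) - u (x + b - r • EuclideanSpace.single i 1))‖ₑ ^ p ≤
        (2 : ℝ≥0∞) ^ (p - 1) * (2 * δ) := by
    intro i
    refine lintegral_sub_diffQuotient_le hp hq (stronglyMeasurable_clm_apply hGm _) hu
      ((ContinuousLinearMap.apply ℝ ℝ _).comp_memLp' hG)
      (fun φ hφ hφc => hw.integral_mul_fderiv φ hφ hφc _) (ρ := ρ) (fun a ha => ?_) hr ?_ ?_
    · refine (lintegral_mono fun x => ?_).trans (hδ a ha)
      gcongr
      rw [← sub_apply, enorm_le_iff_norm_le]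
      refine ((G (x + a) - G x).le_opNorm _).trans (le_of_eq ?_)
      simp
    · rw [hne]
      linarith [norm_nonneg b]
    · refine (norm_sub_le _ _).trans_lt ?_
      rw [hne]
      exact hb
  simp only [gradError]
  rw [lintegral_const_mul _ (Finset.measurable_fun_sum _ fun i _ => hmi i),
    lintegral_finsetSum _ fun i _ => hmi i, mul_assoc]
  gcongr
  refine (Finset.sum_le_sum fun i _ => hi i).trans (le_of_eq ?_)
  rw [Finset.sum_const, Finset.card_univ, Fintype.card_fin, nsmul_eq_mul]
  ring

/-- For strongly measurable `u`, a fine enough grid has many translates for which the interpolant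
is close to `u`. -/
lemma exists_scale_forall_null_exists_shift {p q : ℝ} (hp : 1 ≤ p) (hq : 1 ≤ q)
    {u : EuclideanSpace ℝ (Fin n) → ℝ}
    {G : EuclideanSpace ℝ (Fin n) → (EuclideanSpace ℝ (Fin n) →L[ℝ] ℝ)}
    (hum : StronglyMeasurable u) (hGm : StronglyMeasurable G)
    (hu : MemLp u (ENNReal.ofReal q) volume) (hG : MemLp G (ENNReal.ofReal p) volume)
    (hw : HasWeakDeriv u G) {ε : ℝ≥0∞} (hε : 0 < ε) :
    ∃ r > 0, ∀ N : Set (EuclideanSpace ℝ (Fin n)), volume N = 0 → ∃ k ∉ N,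
      (∫⁻ x, ‖G x - kuhnGrad r (r • k) (fun z => u (gridPoint r (r • k) z)) x‖ₑ ^ p) +
        (∫⁻ x, ‖u x - kuhnInterp r (r • k) (fun z => u (gridPoint r (r • k) z)) x‖ₑ ^ q) ≤ ε := by
  -- `A * δ` bounds the gradient error for each shift `ζ`, and `(A + 1) * δ` includes the error of
  -- the function. `B` multiplies by the volume of the ball of shifts and divides by that of the
  -- cell.
  set A : ℝ≥0∞ := (n : ℝ≥0∞) ^ (p - 1) * (n * ((2 : ℝ≥0∞) ^ (p - 1) * 2)) with hA
  set B : ℝ≥0∞ := (volume (unitCell n))⁻¹ *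
    ((A + 1) * volume (Metric.closedBall (0 : EuclideanSpace ℝ (Fin n)) n)) with hB
  have hAtop : A ≠ ⊤ := by
    have h1 : (n : ℝ≥0∞) ^ (p - 1) ≠ ⊤ :=
      ENNReal.rpow_ne_top_of_nonneg (by linarith) (ENNReal.natCast_ne_top n)
    have h2 : (2 : ℝ≥0∞) ^ (p - 1) ≠ ⊤ :=
      ENNReal.rpow_ne_top_of_nonneg (by linarith) ENNReal.ofNat_ne_top
    exact ENNReal.mul_ne_top h1 (ENNReal.mul_ne_top
      (ENNReal.natCast_ne_top n) (ENNReal.mul_ne_top h2 ENNReal.ofNat_ne_top))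
  have hBtop : B ≠ ⊤ := by
    refine ENNReal.mul_ne_top (ENNReal.inv_ne_top.2 ?_) (ENNReal.mul_ne_top
      (ENNReal.add_ne_top.2 ⟨hAtop, ENNReal.one_ne_top⟩) measure_closedBall_lt_top.ne)
    exact ZSpan.measure_fundamentalDomain_ne_zero _
  obtain ⟨δ, hδ0, hδ⟩ : ∃ δ : ℝ≥0∞, 0 < δ ∧ B * δ ≤ ε := by
    refine ⟨ε / (B + 1), ENNReal.div_pos hε.ne' (ENNReal.add_ne_top.2 ⟨hBtop, ENNReal.one_ne_top⟩),
      ?_⟩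
    calc B * (ε / (B + 1)) ≤ (B + 1) * (ε / (B + 1)) := by gcongr; exact le_self_add
      _ ≤ ε := ENNReal.mul_div_le
  obtain ⟨ρ, hρ, htu⟩ := exists_forall_norm_lt_lintegral_translate_sub_le hq hu hδ0
  obtain ⟨ρ', hρ', htG⟩ := exists_forall_norm_lt_lintegral_translate_sub_le hp hG hδ0
  -- Grid points are at distance at most `r n`, and the edge of a quotient adds another `r`.
  obtain ⟨r, hr0, hrn⟩ : ∃ r : ℝ, 0 < r ∧ r * n + r < min ρ ρ' := by
    have hmin : 0 < min ρ ρ' := lt_min hρ hρ'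
    refine ⟨min ρ ρ' / (n + 2), by positivity, ?_⟩
    rw [div_mul_eq_mul_div, ← add_div, div_lt_iff₀ (by positivity)]
    linarith
  have hnorm : ∀ ζ ∈ Metric.closedBall (0 : EuclideanSpace ℝ (Fin n)) n,
      ‖r • ζ‖ + r < min ρ ρ' := by
    intro ζ hζ
    rw [norm_smul, Real.norm_of_nonneg hr0.le]
    refine lt_of_le_of_lt ?_ hrn
    gcongr
    exact mem_closedBall_zero_iff.1 hζ
  have hfm := measurable_gradError p r hum hGm
  have hfm' : Measurable (Function.uncurry fun x w => ‖u x - u w‖ₑ ^ q) :=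
    Measurable.pow_const (Measurable.enorm ((hum.measurable.comp measurable_fst).sub
      (hum.measurable.comp measurable_snd))) q
  have hbound : ∀ ζ ∈ Metric.closedBall (0 : EuclideanSpace ℝ (Fin n)) n,
      ∫⁻ x, (gradError p r u G x (x + r • ζ) + ‖u x - u (x + r • ζ)‖ₑ ^ q) ≤ (A + 1) * δ := by
    intro ζ hζ
    have hm : Measurable fun x => gradError p r u G x (x + r • ζ) :=
      measurable_comp_add_const hfm (r • ζ)
    rw [lintegral_add_left hm, add_mul, one_mul]
    refine add_le_add (lintegral_gradError_le hp hq hum hGm hu hG hw htG hr0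
      ((hnorm ζ hζ).trans_le (min_le_right _ _))) ?_
    refine le_trans (le_of_eq (lintegral_congr fun x => ?_)) (htu (r • ζ) ?_)
    · rw [← enorm_neg, neg_sub]
    · linarith [hnorm ζ hζ, min_le_left ρ ρ']
  -- The scale is fixed before `N`, because the set of translations to be avoided depends on `r`.
  refine ⟨r, hr0, fun N hN => ?_⟩
  obtain ⟨k, hk, hle⟩ := exists_shift_lintegral_gridSum_le hr0 n
    (f := fun x w => gradError p r u G x w + ‖u x - u w‖ₑ ^ q) (hfm.add hfm') hbound hN
  refine ⟨k, hk, ?_⟩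
  have hgs : Measurable fun x => gridSum r n (gradError p r u G) k x :=
    (measurable_gridSum r n hfm).of_uncurry_left
  calc _ ≤ (∫⁻ x, gridSum r n (gradError p r u G) k x) +
          ∫⁻ x, gridSum r n (fun x w => ‖u x - u w‖ₑ ^ q) k x :=
        add_le_add (lintegral_mono fun x => enorm_sub_kuhnGrad_rpow_le hp hr0 u G k x)
          (lintegral_mono fun x => enorm_sub_kuhnInterp_rpow_le hq hr0 u k x)
    _ = ∫⁻ x, gridSum r n (fun x w => gradError p r u G x w + ‖u x - u w‖ₑ ^ q) k x := by
        rw [← lintegral_add_left hgs]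
        exact lintegral_congr fun x => (gridSum_add r n _ _ k x).symm
    _ ≤ B * δ := hle.trans (le_of_eq (by rw [hB]; ring))
    _ ≤ ε := hδ

end Averaging

/-! ### Lebesgue points, weak derivatives and null sets of translations -/

section WeakDerivative

variable {n : ℕ}

/-- Almost every point is a Lebesgue point. -/
lemma ae_isLebesguePoint {u : EuclideanSpace ℝ (Fin n) → ℝ} (hu : LocallyIntegrable u) :
    ∀ᵐ a, IsLebesguePoint u a := by
  filter_upwards [(Besicovitch.vitaliFamily
    (volume : Measure (EuclideanSpace ℝ (Fin n)))).ae_tendsto_lintegral_enorm_sub_div hu] with a ha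
  have := ha.comp (Besicovitch.tendsto_filterAt volume a)
  refine this.congr' ?_
  filter_upwards [self_mem_nhdsWithin] with ρ hρ
  have hρ' : ρ ≠ 0 := ne_of_gt hρ
  -- The differentiation theorem is available for closed balls. Spheres of nonzero radius are null,
  -- also in dimension 0.
  have hball : Metric.ball a ρ =ᵐ[volume] Metric.closedBall a ρ := by
    refine ae_eq_of_subset_of_measure_ge Metric.ball_subset_closedBall ?_
      measurableSet_ball.nullMeasurableSet measure_closedBall_lt_top.ne
    rw [← Metric.ball_union_sphere]
    refine (measure_union_le _ _).trans ?_
    rw [Measure.addHaar_sphere_of_ne_zero volume a hρ', add_zero]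
  simp only [Function.comp_apply]
  rw [setLAverage_eq, setLIntegral_congr hball, measure_congr hball]

lemma HasWeakDeriv.congr_ae {u u' : EuclideanSpace ℝ (Fin n) → ℝ}
    {G G' : EuclideanSpace ℝ (Fin n) → (EuclideanSpace ℝ (Fin n) →L[ℝ] ℝ)}
    (h : HasWeakDeriv u G) (hu : u =ᵐ[volume] u') (hG : G =ᵐ[volume] G') : HasWeakDeriv u' G' where
  locallyIntegrable := fun x =>
    let ⟨s, hs, hi⟩ := h.locallyIntegrable x
    ⟨s, hs, hi.congr (ae_restrict_of_ae hu)⟩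
  locallyIntegrable_deriv := fun x =>
    let ⟨s, hs, hi⟩ := h.locallyIntegrable_deriv x
    ⟨s, hs, hi.congr (ae_restrict_of_ae hG)⟩
  integral_mul_fderiv := by
    intro φ hφ hφc e
    have h1 : ∫ x, u' x * fderiv ℝ φ x e = ∫ x, u x * fderiv ℝ φ x e := by
      refine integral_congr_ae ?_
      filter_upwards [hu] with x hx
      rw [hx]
    have h2 : ∫ x, G' x e * φ x = ∫ x, G x e * φ x := by
      refine integral_congr_ae ?_
      filter_upwards [hG] with x hx
      rw [hx]
    rw [h1, h2]
    exact h.integral_mul_fderiv φ hφ hφc e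

lemma HasWeakDeriv.sub {u v : EuclideanSpace ℝ (Fin n) → ℝ}
    {G H : EuclideanSpace ℝ (Fin n) → (EuclideanSpace ℝ (Fin n) →L[ℝ] ℝ)}
    (hu : HasWeakDeriv u G) (hv : HasWeakDeriv v H) :
    HasWeakDeriv (fun x => u x - v x) (fun x => G x - H x) where
  locallyIntegrable := hu.locallyIntegrable.sub hv.locallyIntegrable
  locallyIntegrable_deriv := hu.locallyIntegrable_deriv.sub hv.locallyIntegrable_deriv
  integral_mul_fderiv := by
    intro φ hφ hφc e
    have hdφ : Continuous fun x => fderiv ℝ φ x e :=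
      (hφ.continuous_fderiv (by simp)).clm_apply continuous_const
    have hdφc : HasCompactSupport fun x => fderiv ℝ φ x e :=
      (hφc.fderiv ℝ).comp_left (g := fun L : EuclideanSpace ℝ (Fin n) →L[ℝ] ℝ => L e) rfl
    have i1 : ∀ {w : EuclideanSpace ℝ (Fin n) → ℝ}, LocallyIntegrable w →
        Integrable fun x => w x * fderiv ℝ φ x e := fun hw =>
      hw.integrable_smul_right_of_hasCompactSupport hdφ hdφc
    have i2 : ∀ {K : EuclideanSpace ℝ (Fin n) → (EuclideanSpace ℝ (Fin n) →L[ℝ] ℝ)},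
        LocallyIntegrable K → Integrable fun x => K x e * φ x := fun {K} hK => by
      have := (ContinuousLinearMap.apply ℝ ℝ e).integrable_comp
        (hK.integrable_smul_left_of_hasCompactSupport hφ.continuous hφc)
      refine this.congr (Eventually.of_forall fun x => ?_)
      simp [mul_comm]
    simp only [sub_apply, sub_mul]
    rw [integral_sub (i1 hu.locallyIntegrable) (i1 hv.locallyIntegrable),
      integral_sub (i2 hu.locallyIntegrable_deriv) (i2 hv.locallyIntegrable_deriv),
      hu.integral_mul_fderiv φ hφ hφc e, hv.integral_mul_fderiv φ hφ hφc e]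
    ring

/-- Almost every translate of a grid avoids a given null set. -/
lemma measure_exists_gridPoint_notMem_eq_zero {r : ℝ} (hr : 0 < r)
    {P : EuclideanSpace ℝ (Fin n) → Prop} (hP : ∀ᵐ a, P a) :
    volume {k : EuclideanSpace ℝ (Fin n) | ∃ z, ¬ P (gridPoint r (r • k) z)} = 0 := by
  have : {k : EuclideanSpace ℝ (Fin n) | ∃ z, ¬ P (gridPoint r (r • k) z)} =
      ⋃ z : Fin n → ℤ, (fun k => r • k) ⁻¹'
        ((fun a => r • WithLp.toLp 2 (fun i => (z i : ℝ)) + a) ⁻¹' {a | ¬ P a}) := by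
    ext k
    simp [gridPoint]
  rw [this, measure_iUnion_null_iff]
  intro z
  rw [Measure.addHaar_preimage_smul _ hr.ne', measure_preimage_add, ae_iff.1 hP, mul_zero]

end WeakDerivative

/-! ### Choice of the scale and the translation -/

theorem theorem1 (n : ℕ) :
    ∃ T : Geometry.SimplicialComplex ℝ (EuclideanSpace ℝ (Fin n)),
      IsTriangulation T ∧ IsPeriodicComplex T ∧
      ∀ (p q : ℝ), 1 ≤ p → 1 ≤ q →
      ∀ (u : EuclideanSpace ℝ (Fin n) → ℝ)
        (Du : EuclideanSpace ℝ (Fin n) → (EuclideanSpace ℝ (Fin n) →L[ℝ] ℝ)),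
      MemLp u (ENNReal.ofReal q) volume →
      HasWeakDeriv u Du →
      MemLp Du (ENNReal.ofReal p) volume →
      ∀ ε : ℝ, 0 < ε →
      ∃ (r : ℝ) (h : EuclideanSpace ℝ (Fin n))
        (S : Geometry.SimplicialComplex ℝ (EuclideanSpace ℝ (Fin n))),
        0 < r ∧ IsDilatedTranslate T S r h ∧ IsTriangulation S ∧
        (∀ a ∈ S.vertices, IsLebesguePoint u a) ∧
        ∃ (v : EuclideanSpace ℝ (Fin n) → ℝ)
          (H : EuclideanSpace ℝ (Fin n) → (EuclideanSpace ℝ (Fin n) →L[ℝ] ℝ)),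
          IsLagrangeInterpolant S u v ∧
          HasWeakDeriv (fun x => u x - v x) H ∧
          (∫⁻ x, ‖H x‖ₑ ^ p ∂volume) + (∫⁻ x, ‖u x - v x‖ₑ ^ q ∂volume)
            ≤ ENNReal.ofReal ε := by
  refine ⟨kuhnComplex 1 one_pos 0, isTriangulation_kuhnComplex _ _, isPeriodicComplex_kuhnComplex,
    fun p q hp hq u Du hu hw hDu ε hε => ?_⟩
  -- The averaging argument evaluates `u` at two independent points and needs strongly measurable
  -- representatives.
  have hu0 := hu.1.ae_eq_mk
  have hG0 := hDu.1.ae_eq_mk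
  obtain ⟨r, hr, hshift⟩ := exists_scale_forall_null_exists_shift hp hq
    hu.1.stronglyMeasurable_mk hDu.1.stronglyMeasurable_mk (hu.ae_eq hu0) (hDu.ae_eq hG0)
    (hw.congr_ae hu0 hG0) (ENNReal.ofReal_pos.2 hε)
  -- Besides being Lebesgue points, the vertices are required to be points where `u` equals its
  -- representative. The two interpolants then coincide, so the estimate carries over to `u` itself.
  obtain ⟨k, hk, hle⟩ := hshift _ (measure_exists_gridPoint_notMem_eq_zero hr
    ((ae_isLebesguePoint hw.locallyIntegrable).and hu0))
  have hk' : ∀ z, IsLebesguePoint u (gridPoint r (r • k) z) ∧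
      u (gridPoint r (r • k) z) = hu.1.mk u (gridPoint r (r • k) z) := by
    simpa only [Set.mem_ofPred_eq, not_exists, not_not] using hk
  refine ⟨r, r • k, kuhnComplex r hr (r • k), hr, isDilatedTranslate_kuhnComplex hr _,
    isTriangulation_kuhnComplex hr _, fun a ha => ?_, _, _,
    isLagrangeInterpolant_kuhnInterp hr (r • k) u, hw.sub (hasWeakDeriv_kuhnInterp hr _ _), ?_⟩
  · obtain ⟨z, rfl⟩ := (mem_kuhnComplex_vertices hr _ a).1 ha
    exact (hk' z).1
  · simp_rw [fun z => (hk' z).2]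
    refine le_trans (le_of_eq ?_) hle
    congr 1
    · refine lintegral_congr_ae ?_
      filter_upwards [hG0] with x hx
      rw [hx]
    · refine lintegral_congr_ae ?_
      filter_upwards [hu0] with x hx
      rw [hx]
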